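/- **Model.** A quantum switch serves end nodes $1,\dots,K$; time is slotted, $t=0,1,2,\dots$. Doubly indexed quantities are symmetric, $x_{ij}=x_{ji}$, i.e. indexed by unordered pairs, $1\le i,j\le K$. In slot $t$: - $C_{0k}(t)\in\{0,1\}$ EPR pairs are created between the switch and node $k$, with $\mathbb P[C_{0k}(t)=1]=p_k\in[0,1]$; - $A_{ij}(t)\in\mathbb N$ requests arrive for the pair $\{i,j\}$; - the switch performs $F_{ij}(t)\in\mathbb N$ entanglement swapping operations for $\{i,j\}$, each consuming one stored pair of node $i$ and one of node $j$, subject to $\sum_i F_{ij}(t)\le E_{0j}(t)$ for all $j$ (for $i=j$, $F_{jj}$ is counted once in this sum; there is no further limit on the number of swaps); each operation succeeds with probability $q\in[0,1]$, and $R_{ij}(t)$ is the number of successes. With $[x]^+=\max\{x,0\}$ and all queues empty at time $0$, $$U_{ij}(t+1)=[U_{ij}(t)-E_{ij}(t)-R_{ij}(t)]^++A_{ij}(t),\quad E_{ij}(t+1)=[E_{ij}(t)+R_{ij}(t)-U_{ij}(t)]^+,$$ $$E_{0j}(t+1)=E_{0j}(t)-\sum_iF_{ij}(t)+C_{0j}(t).$$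 The request sequences of the different pairs, all variables $C_{0k}(t)$, all swapping outcomes and the private randomness of the protocol are mutually independent. Each sequence $(A_{ij}(t))_{t\ge0}$ is stationary and ergodic with mean $\lambda_{ij}$, and for some $A_{\max}$ one has $\mathbb E[A_{ij}(t)^2\mid H(t)=h]\le A_{\max}^2$ for all $i,j,t$ and all possible $h$, where $H(t)$ is the history $(E_{ij},U_{ij},A_{ij},R_{ij},C_{0i})(\tau)$, $0\le\tau<t$. A protocol chooses $F(t)$ as a function of $H(t)$ and of its private randomness. The switch is *stable* if for all $i,j$ $$\limsup_{t\to\infty}\frac1t\sum_{\tau=0}^{t-1}\mathbb P[U_{ij}(\tau)>V]\longrightarrow0\qquad(V\to\infty).$$ The *capacity region* $\Lambda$ is the closure of the set of rate matrices $(\lambda_{ij})$ for which some protocol stabilizes the switch (for some request processes with these rates as above). **Periods.** Let $\lambda_{ij}\ge0$ and $\varepsilon>0$ be such that $(\lambda_{ij}+\varepsilon)_{i,j}\in\Lambda$. Consider real numbers $\tilde f_{ij}\ge0$ and $\delta>0$ and an integer $T_0\ge1$ such that $$\text{(a)}\quad \sum_i\tilde f_{ij}\le p_j,\qquad \lambda_{ij}+\varepsilon\le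 q\tilde f_{ij},\qquad \lambda_{ij}+\delta+\tfrac\varepsilon4\le q\big(\tilde f_{ij}-\tfrac\varepsilon2\big)(1-\delta)\quad\text{for all } i,j;$$ $$\text{(b)}\quad \mathbb P\big[\min\{X_{ij},Y_{ij}\}<T_0(\tilde f_{ij}-\tfrac\varepsilon2)\big]\le\delta\quad\text{for all } i,j,\ \text{with } X_{ij},Y_{ij}\text{ independent, binomial with parameters } T_0,\tilde f_{ij};$$ $$\text{(c)}\quad \Big|\lambda_{ij}-\frac1{T_0}\sum_{\tau=t_0}^{t_0+T_0-1}\mathbb E[A_{ij}(\tau)\mid H(t_0)=h]\Big|\le\delta\quad\text{for all } i,j,\ t_0\ge0\text{ and all possible } h.$$ **Max weight protocol with period $T_0$.** In the slots $t=mT_0-1$, $m=1,2,\dots$, $F(t)$ is an optimal solution (ties broken arbitrarily) of the integer program: maximize $\sum_{i,j}U_{ij}(t-T_0)F_{ij}$ subject to $\sum_iF_{ij}\le E_{0j}(t)$ for all $j$ and $F_{ij}=F_{ji}\in\mathbb N$, where $U_{ij}(-1):=0$. In all other slots $F(t)=0$. **Theorem.** Let $(\lambda_{ij}+\varepsilon)_{i,j}\in\Lambda$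 with $\lambda_{ij}\ge 0$, $\varepsilon>0$. 1. There are $\tilde f$, $\delta$ and $N$ such that (a) and (b) hold for every $T_0\ge N$. 2. For all $\tilde f,\delta,T_0$ that satisfy (a) and (b), and for all request processes with rates $\lambda_{ij}$ as in the model for which (c) holds, the switch is stable under the max weight protocol with period $T_0$. -/

import Mathlib

open MeasureTheory ProbabilityTheory Filter Topology

noncomputable section

namespace QuantumSwitch

/-- Unordered pairs `{i, j}` of end nodes `i, j ∈ {1, …, K}`.  Quantities with a double index
`x_ij = x_ji` are functions of `s(i, j) : Pair K`. -/
abbrev Pair (K : ℕ) : Type := Sym2 (Fin K)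

/-- What is queued or stored at the beginning of a time slot: `pending {i,j}` is the number `U_ij`
of pending requests, `stored {i,j}` is the number `E_ij` of EPR pairs stored at nodes `i` and `j`,
and `link j` is the number `E_0j` of EPR pairs stored between the switch and node `j`. -/
structure State (K : ℕ) where
  pending : Pair K → ℕ
  stored : Pair K → ℕ
  link : Fin K → ℕ

/-- One run of a switch with `K` end nodes on a sample space `Ω`: the random inputs, and the
decisions that were taken. -/
structure Switch (K : ℕ) (Ω : Type*) where
  /-- `requests t ω {i,j}` is the number `A_ij(t)` of requests arriving during slot `t`. -/
  requests : ℕ → Ω → Pair K → ℕ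
  /-- `generated t ω k`: the attempt in slot `t` to create an EPR pair between the switch and node
  `k` succeeds. -/
  generated : ℕ → Ω → Fin K → Bool
  /-- `outcome t ω e n`: the `n`-th swapping operation for the pair `e` in slot `t`, if it is
  performed, succeeds. -/
  outcome : ℕ → Ω → Pair K → ℕ → Bool
  /-- Information generated by the private randomness of the protocol
  (trivial for a deterministic protocol). -/
  seed : MeasurableSpace Ω
  /-- `decision t ω {i,j}` is the number `F_ij(t)` of swapping operations performed in slot `t` to
  create EPR pairs between `i` and `j`. -/
  decision : ℕ → Ω → Pair K → ℕ

/-- The elementary sources of randomness. -/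
inductive Source (K : ℕ) : Type
  | seed : Source K
  | requests (e : Pair K) : Source K
  | generated (t : ℕ) (k : Fin K) : Source K
  | outcome (t : ℕ) (e : Pair K) (n : ℕ) : Source K

namespace Switch

variable {K : ℕ} {Ω : Type*}

/-- The number `C_0k(t)` of EPR pairs created between the switch and node `k` in slot `t`. -/
def newLinks (S : Switch K Ω) (t : ℕ) (ω : Ω) (k : Fin K) : ℕ := (S.generated t ω k).toNat

/-- The number `R_ij(t)` of successes among the `F_ij(t)` swapping operations of slot `t`. -/
def swapped (S : Switch K Ω) (t : ℕ) (ω : Ω) (e : Pair K) : ℕ :=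
  ((Finset.range (S.decision t ω e)).filter (fun n => S.outcome t ω e n = true)).card

/-- The evolution of the switch.  Subtraction of natural numbers is truncated at `0`, so it is
`[x - y]^+`. -/
def state (S : Switch K Ω) (ω : Ω) : ℕ → State K
  | 0 => ⟨fun _ => 0, fun _ => 0, fun _ => 0⟩
  | t + 1 =>
    ⟨fun e => ((S.state ω t).pending e - ((S.state ω t).stored e + S.swapped t ω e))
        + S.requests t ω e,
      fun e => ((S.state ω t).stored e + S.swapped t ω e) - (S.state ω t).pending e,
      fun j => ((S.state ω t).link j - ∑ i, S.decision t ω s(i, j)) + S.newLinks t ω j⟩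

/-- The number `U_ij(t)` of pending requests. -/
def pending (S : Switch K Ω) (t : ℕ) (ω : Ω) (e : Pair K) : ℕ := (S.state ω t).pending e

/-- The number `E_ij(t)` of EPR pairs stored at two end nodes. -/
def stored (S : Switch K Ω) (t : ℕ) (ω : Ω) (e : Pair K) : ℕ := (S.state ω t).stored e

/-- The number `E_0j(t)` of EPR pairs stored between the switch and node `j`. -/
def link (S : Switch K Ω) (t : ℕ) (ω : Ω) (j : Fin K) : ℕ := (S.state ω t).link j

/-- The type of the observations of one slot: `(E_ij, U_ij, A_ij, R_ij, C_0i)`. -/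
abbrev Observation (K : ℕ) : Type :=
  (Pair K → ℕ) × (Pair K → ℕ) × (Pair K → ℕ) × (Pair K → ℕ) × (Fin K → ℕ)

/-- The history `H(t)`: all observations of the slots `0, …, t - 1`. -/
def history (S : Switch K Ω) (t : ℕ) (ω : Ω) : Fin t → Observation K := fun τ =>
  (S.stored τ ω, S.pending τ ω, S.requests τ ω, S.swapped τ ω, S.newLinks τ ω)

/-- The event that the history of the slots before `t` is `h`. -/
def historyEvent (S : Switch K Ω) (t : ℕ) (h : Fin t → Observation K) : Set Ω :=
  {ω | S.history t ω = h}

/-- The information carried by a source of randomness. -/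
@[reducible] def sourceInfo (S : Switch K Ω) : Source K → MeasurableSpace Ω
  | .seed => S.seed
  | .requests e => MeasurableSpace.comap (fun ω (t : ℕ) => S.requests t ω e) inferInstance
  | .generated t k => MeasurableSpace.comap (fun ω => S.generated t ω k) inferInstance
  | .outcome t e n => MeasurableSpace.comap (fun ω => S.outcome t ω e n) inferInstance

/-- The information on which the decisions of slot `t` may be based: the history and the private
randomness of the protocol. -/
@[reducible] def info (S : Switch K Ω) (t : ℕ) : MeasurableSpace Ω :=
  S.seed ⊔ MeasurableSpace.comap (S.history t) inferInstance

/-- The random inputs follow the model: link pairs are created with probabilities `p k`, swapping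
operations succeed with probability `q`, requests arrive at the rates `lam`. -/
structure IsModel [MeasurableSpace Ω] (S : Switch K Ω) (μ : Measure Ω)
    (p : Fin K → ℝ) (q : ℝ) (lam : Pair K → ℝ) : Prop where
  measurable_seed : ∀ s, MeasurableSet[S.seed] s → MeasurableSet s
  measurable_requests : ∀ t e, Measurable fun ω => S.requests t ω e
  measurable_generated : ∀ t k, Measurable fun ω => S.generated t ω k
  measurable_outcome : ∀ t e n, Measurable fun ω => S.outcome t ω e n
  /-- The request sequences of the different pairs, the creation attempts, the swapping outcomes
  and the private randomness are mutually independent. -/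
  independent : iIndep S.sourceInfo μ
  generated_prob : ∀ t k, μ.real {ω | S.generated t ω k = true} = p k
  outcome_prob : ∀ t e n, μ.real {ω | S.outcome t ω e n = true} = q
  /-- Each request sequence is stationary and ergodic: the shift is measure preserving and ergodic
  for its law on path space. -/
  stationary_ergodic : ∀ e, Ergodic (fun (x : ℕ → ℕ) (t : ℕ) => x (t + 1))
    (μ.map fun ω (t : ℕ) => S.requests t ω e)
  rate : ∀ e, ∫ ω, (S.requests 0 ω e : ℝ) ∂μ = lam e
  /-- Second moments of the requests are bounded, regardless of the history. -/
  second_moment : ∃ Amax : ℝ, ∀ t e h,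
    ∫⁻ ω, (S.requests t ω e : ENNReal) ^ 2 ∂(μ[|S.historyEvent t h]) ≤ ENNReal.ofReal (Amax ^ 2)

/-- The decisions are those of an entanglement swapping protocol: they consume only stored link
pairs, and they depend only on the history and on private randomness. -/
structure IsProtocol (S : Switch K Ω) : Prop where
  feasible : ∀ t ω j, ∑ i, S.decision t ω s(i, j) ≤ S.link t ω j
  nonanticipating : ∀ t, Measurable[S.info t] (S.decision t)

/-- Stability: `g_ij(V) → 0` as `V → ∞`, where `g_ij(V)` is the limit superior, as `t → ∞`, of
`(1/t) ∑_{τ < t} P[U_ij(τ) > V]`. -/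
def IsStable [MeasurableSpace Ω] (S : Switch K Ω) (μ : Measure Ω) : Prop :=
  ∀ e, Tendsto
    (fun V : ℝ => limsup
      (fun t : ℕ => (1 / (t : ℝ)) *
        ∑ τ ∈ Finset.range t, μ.real {ω | V < (S.pending τ ω e : ℝ)}) atTop)
    atTop (𝓝 0)

/-- The max weight protocol with period `T₀`.  In the slots `t = m T₀ - 1`, `m = 1, 2, …`, the
decisions are an optimal solution of the integer program: maximize `∑_{i,j} U_ij(t - T₀) F_ij`
subject to `∑_i F_ij ≤ E_0j(t)`.  In all other slots the switch is idle.  For `m = 1` one has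
`t - T₀ = -1`; the truncated subtraction replaces it by `0`, and `U_ij(0) = 0`, so in that slot
every feasible decision is allowed. -/
structure IsMaxWeight (S : Switch K Ω) (T₀ : ℕ) : Prop where
  optimal : ∀ t, T₀ ∣ t + 1 → ∀ ω (F : Pair K → ℕ),
    (∀ j, ∑ i, F s(i, j) ≤ S.link t ω j) →
      ∑ i, ∑ j, S.pending (t - T₀) ω s(i, j) * F s(i, j) ≤
        ∑ i, ∑ j, S.pending (t - T₀) ω s(i, j) * S.decision t ω s(i, j)
  idle : ∀ t, ¬ T₀ ∣ t + 1 → ∀ ω e, S.decision t ω e = 0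

/-- Given any possible history up to any slot `t₀`, the expected number of requests per slot during
the next `T₀` slots deviates from the rate by at most `δ`. -/
def MeanRequestsNear [MeasurableSpace Ω] (S : Switch K Ω) (μ : Measure Ω)
    (lam : Pair K → ℝ) (δ : ℝ) (T₀ : ℕ) : Prop :=
  ∀ t₀ h, μ (S.historyEvent t₀ h) ≠ 0 → ∀ e,
    |lam e - (1 / (T₀ : ℝ)) * ∑ τ ∈ Finset.Ico t₀ (t₀ + T₀),
      ∫ ω, (S.requests τ ω e : ℝ) ∂(μ[|S.historyEvent t₀ h])| ≤ δ

end Switch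

/-- The rates `lam` for which some protocol stabilizes the switch. -/
def stabilizable {K : ℕ} (p : Fin K → ℝ) (q : ℝ) : Set (Pair K → ℝ) :=
  {lam | ∃ (Ω : Type) (_ : MeasurableSpace Ω) (μ : Measure Ω) (S : Switch K Ω),
    IsProbabilityMeasure μ ∧ S.IsModel μ p q lam ∧ S.IsProtocol ∧ S.IsStable μ}

/-- The capacity region `Λ` (without a limit on the number of swapping operations per slot). -/
def capacityRegion {K : ℕ} (p : Fin K → ℝ) (q : ℝ) : Set (Pair K → ℝ) :=
  closure (stabilizable p q)

/-- The Bernoulli law with mean `x ∈ [0, 1]`. -/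
def bernoulliLaw (x : ℝ) : Measure Bool :=
  ENNReal.ofReal x • Measure.dirac true + ENNReal.ofReal (1 - x) • Measure.dirac false

/-- The law of `n` independent Bernoulli trials with mean `x`. -/
def trialsLaw (n : ℕ) (x : ℝ) : Measure (Fin n → Bool) := Measure.pi fun _ => bernoulliLaw x

/-- The number of successes. -/
def successCount {n : ℕ} (w : Fin n → Bool) : ℕ := (Finset.univ.filter fun τ => w τ = true).card

/-- The conditions on the swapping rates `f`, the tolerance `δ` and the period `T₀` of a protocol
that do not involve the requests beyond their rates `lam`. -/
structure IsPeriod {K : ℕ} (p : Fin K → ℝ) (q : ℝ) (lam : Pair K → ℝ) (ε : ℝ)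
    (f : Pair K → ℝ) (δ : ℝ) (T₀ : ℕ) : Prop where
  f_nonneg : ∀ e, 0 ≤ f e
  sum_f_le : ∀ j, ∑ i, f s(i, j) ≤ p j
  lam_le : ∀ e, lam e + ε ≤ q * f e
  δ_pos : 0 < δ
  δ_small : ∀ e, lam e + δ + ε / 4 ≤ q * (f e - ε / 2) * (1 - δ)
  T₀_pos : 0 < T₀
  /-- The minimum of the numbers of successes in two independent series of `T₀` independent trials
  with mean `f e` is less than `T₀ (f e - ε / 2)` with probability at most `δ`. -/
  trials : ∀ e, ((trialsLaw T₀ (f e)).prod (trialsLaw T₀ (f e))).real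
    {w | ((min (successCount w.1) (successCount w.2) : ℕ) : ℝ) < T₀ * (f e - ε / 2)} ≤ δ

end QuantumSwitch

end

/-!
The first part rests on a necessary condition for stability.  If a protocol is stable, all but few
requests that arrived up to a suitable late time have been served.  The mean number of swapping
operations per slot is then a vector of rates `f` that the creation of link pairs sustains,
`∑ i, f s(i, j) ≤ p j`, and since an operation succeeds with probability `q` independently of the
past, `q f` dominates the request rates up to a small error.  Requests on the exceptional event
are controlled by their second moments.  The sustainable rates form a compact set, so the
domination passes to the closure: `exists_sustainable_of_mem_capacityRegion`.  What remains of `ε`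
leaves room for `δ`, and the condition on the trials is Chebyshev's inequality.

The second part is a Lyapunov argument along the slots `s` with `T₀ ∣ s + 1`.  The decision of slot
`s + T₀` maximizes the weight with respect to the queues `u` of slot `s`.  It can use all link pairs
created since `s`, which are independent of `u`.  Allotting each of them at random to a partner,
such that a pair of node `j` goes to node `i` in a given slot with probability `f s(i, j)`, and
swapping only pairs allotted to each other gives a competitor whose mean is at least
`T₀ (f e - ε / 2) (1 - δ)`.  Hence the expected weighted service is at least
`q T₀ (f e - ε / 2) (1 - δ) E[u e]`, while the requests contribute `T₀ (lam e + δ) E[u e]` up to a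
constant.

Two difficulties have to be met.  Link pairs may accumulate over many periods, so the decisions are
not bounded; but an optimal decision that is truncated at `T₀` still beats all competitors that use
at most `T₀` link pairs per node (`sum_mul_le_sum_mul_min`).  And the weights are one period old when
they are used, while a queue may collapse in the meantime; adding `2 T₀ [u - u']⁺` to the square of
the new queue length `u'` compensates for this, as a large decrease of a queue decreases its square
even more (`sq_add_two_mul_sub_add_le`).  The resulting drift inequality `meanLyapunov_add_le` bounds
the time averages of the expected queue lengths, and stability is Markov's inequality.
-/

namespace QuantumSwitch

open scoped ENNReal

/-! ### Adaptedness -/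

namespace Switch

variable {K : ℕ} {Ω : Type*}

/-- The number of `n < d` with `o n = true` is a measurable function of `d` and `o`. -/
lemma measurable_card_filter_range :
    Measurable fun x : ℕ × (ℕ → Bool) =>
      ((Finset.range x.1).filter fun n => x.2 n = true).card := by
  refine measurable_from_prod_countable_right fun d => ?_
  simp only [Finset.card_filter]
  refine Finset.measurable_sum _ fun n _ => ?_
  exact (measurable_of_countable fun b : Bool => if b = true then 1 else 0).comp
    (measurable_pi_apply n)

/-- The history up to slot `t` and the decision of slot `t` are measurable for every σ-algebra
that contains the private randomness and all inputs of the slots before `t`. -/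
lemma measurable_history_decision [m : MeasurableSpace Ω] (S : Switch K Ω) (hP : S.IsProtocol)
    (t : ℕ) (hseed : S.seed ≤ m) (hreq : ∀ s, Measurable (S.requests s))
    (hgen : ∀ s < t, Measurable (S.generated s)) (hout : ∀ s < t, Measurable (S.outcome s)) :
    Measurable (S.history t) ∧ Measurable (S.decision t) ∧ Measurable (S.pending t) ∧
      Measurable (S.stored t) ∧ Measurable (S.link t) := by
  induction t with
  | zero =>
    have h0 : Measurable (S.history 0) := measurable_pi_iff.mpr fun i => i.elim0
    refine ⟨h0, ?_, ?_, ?_, ?_⟩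
    · exact (hP.nonanticipating 0).mono (sup_le hseed h0.comap_le) le_rfl
    all_goals
      have : ∀ ω, S.state ω 0 = ⟨fun _ => 0, fun _ => 0, fun _ => 0⟩ := fun ω => rfl
      simp only [Switch.pending, Switch.stored, Switch.link, this, measurable_pi_iff]
      exact fun _ => measurable_const
  | succ t ih =>
    obtain ⟨hh, hd, hpe, hst, hli⟩ := ih (fun s hs => hgen s (by omega))
      (fun s hs => hout s (by omega))
    have hsw : Measurable (S.swapped t) := measurable_pi_iff.mpr fun e =>
      measurable_card_filter_range.comp
        ((measurable_pi_iff.mp hd e).prodMk (measurable_pi_iff.mp (hout t (by omega)) e))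
    have hnl : Measurable (S.newLinks t) := measurable_pi_iff.mpr fun k =>
      (measurable_of_countable Bool.toNat).comp (measurable_pi_iff.mp (hgen t (by omega)) k)
    have hh' : Measurable (S.history (t + 1)) := by
      refine measurable_pi_iff.mpr fun i => ?_
      refine Fin.lastCases ?_ (fun i => ?_) i
      · exact hst.prodMk (hpe.prodMk ((hreq t).prodMk (hsw.prodMk hnl)))
      · exact measurable_pi_iff.mp hh i
    rw [measurable_pi_iff] at hpe hst hli hsw hnl hd
    have hreq' := fun s => measurable_pi_iff.mp (hreq s)
    refine ⟨hh', ?_, ?_, ?_, ?_⟩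
    · exact (hP.nonanticipating _).mono (sup_le hseed hh'.comap_le) le_rfl
    · exact measurable_pi_iff.mpr fun e =>
        ((hpe e).sub ((hst e).add (hsw e))).add (hreq' t e)
    · exact measurable_pi_iff.mpr fun e => ((hst e).add (hsw e)).sub (hpe e)
    · exact measurable_pi_iff.mpr fun j =>
        ((hli j).sub (Finset.measurable_sum _ fun i _ => hd s(i, j))).add (hnl j)

/-- The sources of randomness that are resolved before slot `t`; the request sequences and the
private randomness are counted among them in full. -/
def pastSources (K t : ℕ) : Set (Source K) :=
  {x | match x with
    | .seed => True
    | .requests _ => True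
    | .generated s _ => s < t
    | .outcome s _ _ => s < t}

/-- The information carried by the sources that are resolved before slot `t`. -/
@[reducible] def past (S : Switch K Ω) (t : ℕ) : MeasurableSpace Ω :=
  ⨆ x ∈ pastSources K t, S.sourceInfo x

lemma sourceInfo_le_past (S : Switch K Ω) {t : ℕ} {x : Source K} (hx : x ∈ pastSources K t) :
    S.sourceInfo x ≤ S.past t := le_iSup₂_of_le x hx le_rfl

lemma past_measurable (S : Switch K Ω) (hP : S.IsProtocol) (t : ℕ) :
    Measurable[S.past t] (S.history t) ∧ Measurable[S.past t] (S.decision t) ∧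
      Measurable[S.past t] (S.pending t) ∧ Measurable[S.past t] (S.stored t) ∧
      Measurable[S.past t] (S.link t) := by
  refine measurable_history_decision (m := S.past t) S hP t ?_ ?_ ?_ ?_
  · exact S.sourceInfo_le_past (x := .seed) trivial
  · refine fun s => (@measurable_pi_iff _ _ _ (S.past t) _ _).mpr fun e => ?_
    have h : Measurable[S.past t] fun ω (t : ℕ) => S.requests t ω e :=
      Measurable.mono (comap_measurable _)
        (S.sourceInfo_le_past (x := .requests e) trivial) le_rfl
    exact (measurable_pi_apply s).comp h
  · refine fun s hs => (@measurable_pi_iff _ _ _ (S.past t) _ _).mpr fun k => ?_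
    exact Measurable.mono (comap_measurable _)
      (S.sourceInfo_le_past (x := .generated s k) hs) le_rfl
  · refine fun s hs => (@measurable_pi_iff _ _ _ (S.past t) _ _).mpr fun e => ?_
    refine (@measurable_pi_iff _ _ _ (S.past t) _ _).mpr fun n => ?_
    exact Measurable.mono (comap_measurable _)
      (S.sourceInfo_le_past (x := .outcome s e n) hs) le_rfl

/-- The number of successes among the first `d` swapping operations for the pair `e` in slot `t`,
should these be performed. -/
def successes (S : Switch K Ω) (t : ℕ) (e : Pair K) (d : ℕ) (ω : Ω) : ℕ :=
  ((Finset.range d).filter fun n => S.outcome t ω e n = true).card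

lemma successes_mono (S : Switch K Ω) (t : ℕ) (e : Pair K) (ω : Ω) :
    Monotone fun d => S.successes t e d ω := fun _ _ h =>
  Finset.card_le_card (Finset.filter_subset_filter _ (Finset.range_subset_range.mpr h))

lemma successes_le (S : Switch K Ω) (t : ℕ) (e : Pair K) (d : ℕ) (ω : Ω) :
    S.successes t e d ω ≤ d :=
  (Finset.card_filter_le _ _).trans (Finset.card_range d).le

section Model

variable [mΩ : MeasurableSpace Ω] {S : Switch K Ω} {μ : Measure Ω} {p : Fin K → ℝ} {q : ℝ}
  {lam : Pair K → ℝ}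

lemma IsModel.sourceInfo_le (hM : S.IsModel μ p q lam) (x : Source K) : S.sourceInfo x ≤ mΩ := by
  cases x with
  | seed => exact hM.measurable_seed
  | requests e => exact (measurable_pi_iff.mpr fun t => hM.measurable_requests t e).comap_le
  | generated t k => exact (hM.measurable_generated t k).comap_le
  | outcome t e n => exact (hM.measurable_outcome t e n).comap_le

lemma IsModel.past_le (hM : S.IsModel μ p q lam) (t : ℕ) : S.past t ≤ mΩ :=
  iSup₂_le fun x _ => hM.sourceInfo_le x

/-- Sources that are not resolved before slot `t` are independent of those that are. -/
lemma IsModel.indep_past (hM : S.IsModel μ p q lam) {t : ℕ} {T : Set (Source K)}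
    (hT : Disjoint (pastSources K t) T) : Indep (S.past t) (⨆ x ∈ T, S.sourceInfo x) μ :=
  indep_iSup_of_disjoint hM.sourceInfo_le hM.independent hT

lemma IsModel.measurable_history (hM : S.IsModel μ p q lam) (hP : S.IsProtocol) (t : ℕ) :
    Measurable (S.history t) :=
  (S.past_measurable hP t).1.mono (hM.past_le t) le_rfl

lemma IsModel.measurable_decision (hM : S.IsModel μ p q lam) (hP : S.IsProtocol) (t : ℕ)
    (e : Pair K) : Measurable fun ω => S.decision t ω e :=
  measurable_pi_iff.mp ((S.past_measurable hP t).2.1.mono (hM.past_le t) le_rfl) e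

lemma IsModel.measurable_pending (hM : S.IsModel μ p q lam) (hP : S.IsProtocol) (t : ℕ)
    (e : Pair K) : Measurable fun ω => S.pending t ω e :=
  measurable_pi_iff.mp ((S.past_measurable hP t).2.2.1.mono (hM.past_le t) le_rfl) e

lemma IsModel.measurable_successes (hM : S.IsModel μ p q lam) (t : ℕ) (e : Pair K)
    {G : Ω → ℕ} (hG : Measurable G) : Measurable fun ω => S.successes t e (G ω) ω :=
  measurable_card_filter_range.comp
    (hG.prodMk (measurable_pi_iff.mpr fun n => hM.measurable_outcome t e n))

/-- Wald's identity: the number of operations is decided before their outcomes are known. -/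
lemma IsModel.lintegral_mul_successes [IsProbabilityMeasure μ] (hM : S.IsModel μ p q lam) (t : ℕ)
    (e : Pair K) {w G : Ω → ℕ} (hw : Measurable[S.past t] w) (hG : Measurable[S.past t] G) :
    ∫⁻ ω, ((w ω * S.successes t e (G ω) ω : ℕ) : ℝ≥0∞) ∂μ =
      ENNReal.ofReal q * ∫⁻ ω, ((w ω * G ω : ℕ) : ℝ≥0∞) ∂μ := by
  have hle := hM.past_le t
  have hw' : Measurable w := hw.mono hle le_rfl
  have hG' : Measurable G := hG.mono hle le_rfl
  have hlt : ∀ n, MeasurableSet[S.past t] {ω | n < G ω} := fun n => hG (measurableSet_Ioi (a := n))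
  have hout : ∀ n, MeasurableSet {ω | S.outcome t ω e n = true} := fun n =>
    hM.measurable_outcome t e n (measurableSet_singleton true)
  have hgm : ∀ n, Measurable[S.past t] fun ω =>
      (w ω : ℝ≥0∞) * {ω | n < G ω}.indicator (fun _ => 1) ω := fun n =>
    ((measurable_of_countable (fun k : ℕ => (k : ℝ≥0∞))).comp hw).mul
      (measurable_const.indicator (hlt n))
  have hom : ∀ n, Measurable fun ω =>
      {ω | S.outcome t ω e n = true}.indicator (fun _ => (1 : ℝ≥0∞)) ω := fun n =>
    measurable_const.indicator (hout n)
  have key : ∀ n, ∫⁻ ω, (w ω : ℝ≥0∞) * {ω | n < G ω}.indicator (fun _ => 1) ω *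
      {ω | S.outcome t ω e n = true}.indicator (fun _ => 1) ω ∂μ =
      ENNReal.ofReal q * ∫⁻ ω, (w ω : ℝ≥0∞) * {ω | n < G ω}.indicator (fun _ => 1) ω ∂μ := by
    intro n
    have hind : Indep (S.past t) (S.sourceInfo (.outcome t e n)) μ := by
      have := hM.indep_past (t := t) (T := {.outcome t e n}) (by
        rw [Set.disjoint_singleton_right]; exact fun h => absurd h (lt_irrefl t))
      simpa using this
    rw [lintegral_mul_eq_lintegral_mul_lintegral_of_independent_measurableSpace hle
      (hM.sourceInfo_le _) hind (hgm n) ?_, mul_comm]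
    · congr 1
      rw [lintegral_indicator_const (hout n), one_mul, ← hM.outcome_prob t e n, ofReal_measureReal]
    · exact measurable_const.indicator ⟨{true}, measurableSet_singleton _, rfl⟩
  -- `n < G` is decided before the `n`-th outcome, so the sum over `n` factorizes termwise.
  have hsum : ∀ ω, ((w ω * S.successes t e (G ω) ω : ℕ) : ℝ≥0∞) =
      ∑' n, (w ω : ℝ≥0∞) * {ω | n < G ω}.indicator (fun _ => 1) ω *
        {ω | S.outcome t ω e n = true}.indicator (fun _ => 1) ω := by
    intro ω
    rw [tsum_eq_sum (s := Finset.range (G ω))]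
    · simp only [successes, Finset.card_filter, Nat.cast_mul, Nat.cast_sum, Finset.mul_sum]
      refine Finset.sum_congr rfl fun n hn => ?_
      simp only [Finset.mem_range] at hn
      by_cases h : S.outcome t ω e n = true <;> simp [Set.indicator, hn, h]
    · intro n hn
      have : ¬ n < G ω := by simpa using hn
      simp [Set.indicator, this]
  have hsum' : ∀ ω, ((w ω * G ω : ℕ) : ℝ≥0∞) =
      ∑' n, (w ω : ℝ≥0∞) * {ω | n < G ω}.indicator (fun _ => 1) ω := by
    intro ω
    rw [tsum_eq_sum (s := Finset.range (G ω))]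
    · rw [← Finset.mul_sum, Finset.sum_congr rfl (g := fun _ => (1 : ℝ≥0∞))]
      · simp
      · intro n hn
        have : n < G ω := by simpa using hn
        simp [Set.indicator, this]
    · intro n hn
      have : ¬ n < G ω := by simpa using hn
      simp [Set.indicator, this]
  simp_rw [hsum, hsum']
  rw [lintegral_tsum, lintegral_tsum fun n => ((hgm n).mono hle le_rfl).aemeasurable,
    ← ENNReal.tsum_mul_left]
  · exact tsum_congr key
  · exact fun n => (((hgm n).mono hle le_rfl).mul (hom n)).aemeasurable

/-- The one-dimensional laws of a request sequence do not depend on the slot. -/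
lemma IsModel.lintegral_requests_eq (hM : S.IsModel μ p q lam) (g : ℕ → ℝ≥0∞) (t : ℕ)
    (e : Pair K) : ∫⁻ ω, g (S.requests t ω e) ∂μ = ∫⁻ ω, g (S.requests 0 ω e) ∂μ := by
  have hm : Measurable fun ω (t : ℕ) => S.requests t ω e :=
    measurable_pi_iff.mpr fun t => hM.measurable_requests t e
  have hpath : ∀ s, ∫⁻ x : ℕ → ℕ, g (x s) ∂(μ.map fun ω (t : ℕ) => S.requests t ω e) =
      ∫⁻ ω, g (S.requests s ω e) ∂μ := fun s =>
    lintegral_map ((measurable_of_countable g).comp (measurable_pi_apply s)) hm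
  induction t with
  | zero => rfl
  | succ t ih =>
    rw [← ih, ← hpath, ← hpath]
    exact ((hM.stationary_ergodic e).toMeasurePreserving.lintegral_comp
      ((measurable_of_countable g).comp (measurable_pi_apply t)))

/-- The second moments of the requests are finite, uniformly over slots and pairs. -/
lemma IsModel.exists_sq_le [IsProbabilityMeasure μ] (hM : S.IsModel μ p q lam) :
    ∃ M : ℝ, 0 ≤ M ∧ ∀ t e, ∫⁻ ω, (S.requests t ω e : ℝ≥0∞) ^ 2 ∂μ ≤ ENNReal.ofReal M := by
  obtain ⟨A, hA⟩ := hM.second_moment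
  refine ⟨A ^ 2, sq_nonneg A, fun t e => ?_⟩
  rw [hM.lintegral_requests_eq (fun n => (n : ℝ≥0∞) ^ 2)]
  have h0 : S.historyEvent 0 (fun i => i.elim0) = Set.univ :=
    Set.eq_univ_of_forall fun ω => funext fun i => i.elim0
  simpa [h0, cond_univ] using hA 0 e fun i => i.elim0

lemma IsModel.lintegral_requests_lt_top [IsProbabilityMeasure μ] (hM : S.IsModel μ p q lam)
    (t : ℕ) (e : Pair K) : ∫⁻ ω, (S.requests t ω e : ℝ≥0∞) ∂μ < ∞ := by
  obtain ⟨M, -, hMs⟩ := hM.exists_sq_le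
  refine lt_of_le_of_lt (lintegral_mono fun ω => ?_) ((hMs t e).trans_lt ENNReal.ofReal_lt_top)
  have : S.requests t ω e ≤ S.requests t ω e ^ 2 := Nat.le_self_pow (by norm_num) _
  rw [← Nat.cast_pow]
  exact Nat.cast_le.mpr this

lemma IsModel.lintegral_requests [IsProbabilityMeasure μ] (hM : S.IsModel μ p q lam)
    (t : ℕ) (e : Pair K) : ∫⁻ ω, (S.requests t ω e : ℝ≥0∞) ∂μ = ENNReal.ofReal (lam e) := by
  rw [hM.lintegral_requests_eq (fun n => (n : ℝ≥0∞)), ← hM.rate e,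
    ofReal_integral_eq_lintegral_ofReal]
  · simp
  · have hm : Measurable fun ω => (S.requests 0 ω e : ℝ) :=
      (measurable_of_countable fun n : ℕ => (n : ℝ)).comp (hM.measurable_requests 0 e)
    refine ⟨hm.aestronglyMeasurable, ?_⟩
    rw [hasFiniteIntegral_iff_ofReal (ae_of_all _ fun ω => Nat.cast_nonneg _)]
    simpa using hM.lintegral_requests_lt_top 0 e
  · exact ae_of_all _ fun ω => Nat.cast_nonneg _

lemma IsModel.lintegral_newLinks [IsProbabilityMeasure μ] (hM : S.IsModel μ p q lam)
    (t : ℕ) (k : Fin K) : ∫⁻ ω, (S.newLinks t ω k : ℝ≥0∞) ∂μ = ENNReal.ofReal (p k) := by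
  have hms : MeasurableSet {ω | S.generated t ω k = true} :=
    hM.measurable_generated t k (measurableSet_singleton true)
  rw [← hM.generated_prob t k, ofReal_measureReal, ← one_mul (μ _),
    ← lintegral_indicator_const hms]
  refine lintegral_congr fun ω => ?_
  by_cases h : S.generated t ω k = true <;> simp [newLinks, Set.indicator, h]

end Model

end Switch

/-! ### Necessary conditions for stability -/

namespace Switch

variable {K : ℕ} {Ω : Type*}

/-- Conservation of requests. -/
lemma sum_requests_add_stored (S : Switch K Ω) (t : ℕ) (ω : Ω) (e : Pair K) :
    ∑ τ ∈ Finset.range t, S.requests τ ω e + S.stored t ω e =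
      S.pending t ω e + ∑ τ ∈ Finset.range t, S.swapped τ ω e := by
  induction t with
  | zero => rfl
  | succ t ih =>
    have h1 : S.pending (t + 1) ω e =
      (S.pending t ω e - (S.stored t ω e + S.swapped t ω e)) + S.requests t ω e := rfl
    have h2 : S.stored (t + 1) ω e =
      (S.stored t ω e + S.swapped t ω e) - S.pending t ω e := rfl
    rw [Finset.sum_range_succ, Finset.sum_range_succ, h1, h2]
    omega

/-- Conservation of link pairs. -/
lemma IsProtocol.link_add_sum {S : Switch K Ω} (hP : S.IsProtocol) (t : ℕ) (ω : Ω) (j : Fin K) :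
    S.link t ω j + ∑ τ ∈ Finset.range t, ∑ i, S.decision τ ω s(i, j) =
      ∑ τ ∈ Finset.range t, S.newLinks τ ω j := by
  induction t with
  | zero => rfl
  | succ t ih =>
    have h1 : S.link (t + 1) ω j =
      (S.link t ω j - ∑ i, S.decision t ω s(i, j)) + S.newLinks t ω j := rfl
    have h2 := hP.feasible t ω j
    rw [Finset.sum_range_succ, Finset.sum_range_succ, h1]
    omega

end Switch

/-- The rates of swapping operations that the creation of link pairs can sustain. -/
def sustainable {K : ℕ} (p : Fin K → ℝ) : Set (Pair K → ℝ) :=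
  {f | (∀ e, 0 ≤ f e) ∧ ∀ j, ∑ i, f s(i, j) ≤ p j}

lemma le_of_mem_sustainable {K : ℕ} {p : Fin K → ℝ} {f : Pair K → ℝ} (hf : f ∈ sustainable p)
    (i j : Fin K) : f s(i, j) ≤ p j :=
  (Finset.single_le_sum (f := fun i => f s(i, j)) (fun _ _ => hf.1 _)
    (Finset.mem_univ i)).trans (hf.2 j)

lemma isCompact_sustainable {K : ℕ} (p : Fin K → ℝ) : IsCompact (sustainable p) := by
  have hcl : IsClosed (sustainable p) := by
    have : sustainable p =
        (⋂ e, {f | 0 ≤ f e}) ∩ ⋂ j, {f : Pair K → ℝ | ∑ i, f s(i, j) ≤ p j} := by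
      ext f; simp [sustainable]
    rw [this]
    refine (isClosed_iInter fun e => isClosed_le continuous_const (continuous_apply e)).inter
      (isClosed_iInter fun j => isClosed_le
        (continuous_finsetSum _ fun i _ => continuous_apply _) continuous_const)
  refine (isCompact_univ_pi fun e : Pair K =>
    isCompact_Icc (a := (0 : ℝ)) (b := ∑ j, |p j|)).of_isClosed_subset hcl fun f hf e _ => ?_
  refine ⟨hf.1 e, ?_⟩
  induction e using Sym2.ind with
  | _ i j =>
    exact ((le_of_mem_sustainable hf i j).trans (le_abs_self _)).trans
      (Finset.single_le_sum (f := fun j => |p j|) (fun _ _ => abs_nonneg _) (Finset.mem_univ j))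

namespace Switch

variable {K : ℕ} {Ω : Type*} [mΩ : MeasurableSpace Ω] {S : Switch K Ω} {μ : Measure Ω}
  [IsProbabilityMeasure μ] {p : Fin K → ℝ} {q : ℝ} {lam : Pair K → ℝ}

/-- The mean number of swapping operations per slot for the pair `e` during the first `t` slots. -/
noncomputable def meanDecision (S : Switch K Ω) (μ : Measure Ω) (t : ℕ) (e : Pair K) : ℝ :=
  (∑ τ ∈ Finset.range t, ∫⁻ ω, (S.decision τ ω e : ℝ≥0∞) ∂μ).toReal / t

lemma sum_lintegral_decision_le (hM : S.IsModel μ p q lam) (hP : S.IsProtocol) (t : ℕ)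
    (j : Fin K) :
    ∑ i, ∑ τ ∈ Finset.range t, ∫⁻ ω, (S.decision τ ω s(i, j) : ℝ≥0∞) ∂μ ≤
      t * ENNReal.ofReal (p j) := by
  have hm : ∀ τ e, Measurable fun ω => (S.decision τ ω e : ℝ≥0∞) := fun τ e =>
    (measurable_of_countable fun n : ℕ => (n : ℝ≥0∞)).comp (hM.measurable_decision hP τ e)
  calc ∑ i, ∑ τ ∈ Finset.range t, ∫⁻ ω, (S.decision τ ω s(i, j) : ℝ≥0∞) ∂μ
      = ∫⁻ ω, ((∑ τ ∈ Finset.range t, ∑ i, S.decision τ ω s(i, j) : ℕ) : ℝ≥0∞) ∂μ := by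
        push_cast
        rw [Finset.sum_comm, lintegral_finsetSum _ fun τ _ =>
          Finset.measurable_sum _ fun i _ => hm τ _]
        exact Finset.sum_congr rfl fun τ _ => (lintegral_finsetSum _ fun i _ => hm τ _).symm
    _ ≤ ∫⁻ ω, ((∑ τ ∈ Finset.range t, S.newLinks τ ω j : ℕ) : ℝ≥0∞) ∂μ := by
        refine lintegral_mono fun ω => Nat.cast_le.mpr ?_
        have := hP.link_add_sum t ω j
        omega
    _ = t * ENNReal.ofReal (p j) := by
        push_cast
        rw [lintegral_finsetSum _ fun τ _ => ?_]
        · simp [hM.lintegral_newLinks]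
        · exact ((measurable_of_countable fun b : Bool => ((b.toNat : ℕ) : ℝ≥0∞))).comp
            (hM.measurable_generated τ j)

lemma sum_lintegral_decision_ne_top (hM : S.IsModel μ p q lam) (hP : S.IsProtocol) (t : ℕ)
    (e : Pair K) : ∑ τ ∈ Finset.range t, ∫⁻ ω, (S.decision τ ω e : ℝ≥0∞) ∂μ ≠ ∞ := by
  induction e using Sym2.ind with
  | _ i j =>
    refine ne_top_of_le_ne_top (ENNReal.mul_ne_top (ENNReal.natCast_ne_top t)
      (ENNReal.ofReal_ne_top (r := p j))) (le_trans ?_ (sum_lintegral_decision_le hM hP t j))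
    exact Finset.single_le_sum
      (f := fun i => ∑ τ ∈ Finset.range t, ∫⁻ ω, (S.decision τ ω s(i, j) : ℝ≥0∞) ∂μ)
      (fun _ _ => zero_le) (Finset.mem_univ i)

lemma meanDecision_mem_sustainable (hp : ∀ k, 0 ≤ p k) (hM : S.IsModel μ p q lam)
    (hP : S.IsProtocol) (t : ℕ) : S.meanDecision μ t ∈ sustainable p := by
  refine ⟨fun e => by unfold meanDecision; positivity, fun j => ?_⟩
  rcases Nat.eq_zero_or_pos t with rfl | ht
  · simpa [meanDecision] using hp j
  · have ht' : (0 : ℝ) < t := by exact_mod_cast ht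
    simp only [meanDecision]
    rw [← Finset.sum_div, div_le_iff₀ ht',
      ← ENNReal.toReal_sum fun i _ => sum_lintegral_decision_ne_top hM hP t _]
    refine (ENNReal.toReal_mono (ENNReal.mul_ne_top (ENNReal.natCast_ne_top t)
      ENNReal.ofReal_ne_top) (sum_lintegral_decision_le hM hP t j)).trans_eq ?_
    rw [ENNReal.toReal_mul, ENNReal.toReal_natCast, ENNReal.toReal_ofReal (hp j), mul_comm]

/-- If the queue of the pair `e` is short with high probability in slot `t`, then the requests
that have arrived must have been served, up to a small error.  The requests on the exceptional event
are controlled by their second moments `M`, using `a 1_B ≤ c a² + c⁻¹ 1_B`. -/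
lemma mul_rate_le {e : Pair K} (hq : 0 ≤ q) (hM : S.IsModel μ p q lam) (hP : S.IsProtocol)
    {M : ℝ} (hM0 : 0 ≤ M)
    (hsq : ∀ t e, ∫⁻ ω, (S.requests t ω e : ℝ≥0∞) ^ 2 ∂μ ≤ ENNReal.ofReal M) {c : ℝ} (hc : 0 < c)
    (t : ℕ) (V : ℝ) (hV : 0 ≤ V) :
    t * lam e ≤ V + q * (t * S.meanDecision μ t e) +
      t * (c * M + c⁻¹ * μ.real {ω | V < (S.pending t ω e : ℝ)}) := by
  set B : Set Ω := {ω | V < (S.pending t ω e : ℝ)} with hB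
  have hBm : MeasurableSet B := by
    have := hM.measurable_pending hP t e
    exact measurableSet_lt measurable_const
      ((measurable_of_countable fun n : ℕ => (n : ℝ)).comp this)
  have hAm : ∀ τ, Measurable fun ω => (S.requests τ ω e : ℝ≥0∞) := fun τ =>
    (measurable_of_countable fun n : ℕ => (n : ℝ≥0∞)).comp (hM.measurable_requests τ e)
  have hRm : ∀ τ, Measurable fun ω => (S.swapped τ ω e : ℝ≥0∞) := fun τ =>
    (measurable_of_countable fun n : ℕ => (n : ℝ≥0∞)).comp
      (hM.measurable_successes τ e (hM.measurable_decision hP τ e))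
  have hpt : ∀ ω, (∑ τ ∈ Finset.range t, (S.requests τ ω e : ℝ≥0∞)) ≤
      ENNReal.ofReal V + ∑ τ ∈ Finset.range t, (S.swapped τ ω e : ℝ≥0∞) +
      ∑ τ ∈ Finset.range t, (ENNReal.ofReal c * (S.requests τ ω e : ℝ≥0∞) ^ 2 +
        B.indicator (fun _ => ENNReal.ofReal c⁻¹) ω) := by
    intro ω
    by_cases hω : ω ∈ B
    · refine le_trans (Finset.sum_le_sum fun τ _ => ?_) le_add_self
      rw [Set.indicator_of_mem hω, ← ENNReal.ofReal_natCast, ← ENNReal.ofReal_pow (by positivity),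
        ← ENNReal.ofReal_mul hc.le, ← ENNReal.ofReal_add (by positivity) (by positivity)]
      refine ENNReal.ofReal_le_ofReal ?_
      set a : ℝ := (S.requests τ ω e : ℝ)
      have h1 : c * a ^ 2 + c⁻¹ - a = c * (a - c⁻¹ / 2) ^ 2 + c⁻¹ * (3 / 4) := by
        field_simp; ring
      have h2 : 0 ≤ c * (a - c⁻¹ / 2) ^ 2 + c⁻¹ * (3 / 4) := by positivity
      linarith
    · have hle : (S.pending t ω e : ℝ) ≤ V := not_lt.mp hω
      refine le_trans ?_ le_self_add
      have h1 := S.sum_requests_add_stored t ω e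
      have h2 : ∑ τ ∈ Finset.range t, S.requests τ ω e ≤
        S.pending t ω e + ∑ τ ∈ Finset.range t, S.swapped τ ω e := by omega
      have h3 : ((∑ τ ∈ Finset.range t, S.requests τ ω e : ℕ) : ℝ≥0∞) ≤
        ((S.pending t ω e + ∑ τ ∈ Finset.range t, S.swapped τ ω e : ℕ) : ℝ≥0∞) :=
        Nat.cast_le.mpr h2
      push_cast at h3
      refine h3.trans (add_le_add_left ?_ _)
      rw [← ENNReal.ofReal_natCast]
      exact ENNReal.ofReal_le_ofReal hle
  have hR : ∀ τ, ∫⁻ ω, (S.swapped τ ω e : ℝ≥0∞) ∂μ =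
      ENNReal.ofReal q * ∫⁻ ω, (S.decision τ ω e : ℝ≥0∞) ∂μ := by
    intro τ
    have := hM.lintegral_mul_successes τ e (w := fun _ => 1) (G := fun ω => S.decision τ ω e)
      (@measurable_const _ _ _ (S.past τ) _)
      ((measurable_pi_apply e).comp (S.past_measurable hP τ).2.1)
    simp only [one_mul] at this
    exact this
  have hint := lintegral_mono (μ := μ) hpt
  rw [lintegral_finsetSum _ fun τ _ => hAm τ, lintegral_add_right, lintegral_add_right,
    lintegral_const, lintegral_finsetSum _ fun τ _ => hRm τ, lintegral_finsetSum] at hint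
  rotate_left
  · exact fun τ _ => (measurable_const.mul ((hAm τ).pow_const 2)).add
      (measurable_const.indicator hBm)
  · exact Finset.measurable_sum _ fun τ _ => hRm τ
  · exact Finset.measurable_sum _ fun τ _ => (measurable_const.mul ((hAm τ).pow_const 2)).add
      (measurable_const.indicator hBm)
  have hterm : ∀ τ, ∫⁻ ω, (ENNReal.ofReal c * (S.requests τ ω e : ℝ≥0∞) ^ 2 +
      B.indicator (fun _ => ENNReal.ofReal c⁻¹) ω) ∂μ ≤
      ENNReal.ofReal (c * M + c⁻¹ * μ.real B) := by
    intro τ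
    rw [lintegral_add_right _ (measurable_const.indicator hBm), lintegral_indicator_const hBm,
      lintegral_const_mul _ ((hAm τ).pow_const 2),
      ENNReal.ofReal_add (by positivity) (by positivity), ENNReal.ofReal_mul hc.le,
      ENNReal.ofReal_mul (by positivity), ofReal_measureReal]
    gcongr
    exact hsq τ e
  have hfin := sum_lintegral_decision_ne_top hM hP t e
  have hD : ∑ τ ∈ Finset.range t, ∫⁻ ω, (S.decision τ ω e : ℝ≥0∞) ∂μ =
      ENNReal.ofReal (t * S.meanDecision μ t e) := by
    rcases Nat.eq_zero_or_pos t with rfl | ht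
    · simp
    · have ht' : (t : ℝ) ≠ 0 := by exact_mod_cast ht.ne'
      rw [meanDecision, mul_div_cancel₀ _ ht', ENNReal.ofReal_toReal hfin]
  have hD0 : 0 ≤ t * S.meanDecision μ t e := by unfold meanDecision; positivity
  simp only [hM.lintegral_requests, hR, measure_univ, mul_one, ← Finset.mul_sum, hD,
    Finset.sum_const, Finset.card_range, nsmul_eq_mul] at hint
  have hint2 := hint.trans (add_le_add_right (Finset.sum_le_sum fun τ _ => hterm τ) _)
  rw [Finset.sum_const, Finset.card_range, nsmul_eq_mul, ← ENNReal.ofReal_natCast,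
    ← ENNReal.ofReal_mul (by positivity), ← ENNReal.ofReal_mul hq,
    ← ENNReal.ofReal_mul (by positivity), ← ENNReal.ofReal_add hV (by positivity),
    ← ENNReal.ofReal_add (by positivity) (by positivity)] at hint2
  exact (ENNReal.ofReal_le_ofReal_iff (by positivity)).mp hint2

end Switch

/-- If the time averages of finitely many bounded sequences have small limits superior, then the
sequences are simultaneously small at arbitrarily late times. -/
lemma exists_ge_forall_lt_of_limsup_average_lt {ι : Type*} [Fintype ι] (x : ι → ℕ → ℝ)
    (h0 : ∀ i n, 0 ≤ x i n) (h1 : ∀ i n, x i n ≤ 1) {η : ℝ} (hη : 0 < η)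
    (hlim : ∀ i, limsup (fun t : ℕ => (1 / (t : ℝ)) * ∑ τ ∈ Finset.range t, x i τ) atTop <
      η / (2 * (Fintype.card ι + 1))) (N : ℕ) :
    ∃ t, N ≤ t ∧ ∀ i, x i t < η := by
  by_contra hcon
  push Not at hcon
  have hev : ∀ᶠ t : ℕ in atTop, ∀ i, (1 / (t : ℝ)) * ∑ τ ∈ Finset.range t, x i τ <
      η / (2 * (Fintype.card ι + 1)) := by
    rw [eventually_all]
    refine fun i => eventually_lt_of_limsup_lt (hlim i) ?_
    refine isBoundedUnder_of ⟨1, fun t => ?_⟩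
    rcases Nat.eq_zero_or_pos t with rfl | ht
    · simp
    · have ht' : (0 : ℝ) < t := by exact_mod_cast ht
      rw [one_div, inv_mul_le_iff₀ ht']
      simpa using Finset.sum_le_sum fun τ (_ : τ ∈ Finset.range t) => h1 i τ
  obtain ⟨T, hT⟩ := eventually_atTop.mp hev
  set t := max T (2 * N + 1) with ht
  have htpos : (0 : ℝ) < t := by
    have : 0 < t := by omega
    exact_mod_cast this
  have hlow : η * (t / 2) ≤ ∑ τ ∈ Finset.range t, ∑ i, x i τ := by
    have hbig : ∀ τ ∈ Finset.Ico N t, η ≤ ∑ i, x i τ := by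
      intro τ hτ
      obtain ⟨i, hi⟩ := hcon τ (Finset.mem_Ico.mp hτ).1
      exact hi.trans (Finset.single_le_sum (f := fun i => x i τ) (fun i _ => h0 i τ)
        (Finset.mem_univ i))
    have hcast : (t : ℝ) / 2 ≤ ((t - N : ℕ) : ℝ) := by
      rw [Nat.cast_sub (by omega)]
      have : (2 * N : ℝ) ≤ t := by
        have : 2 * N ≤ t := by omega
        exact_mod_cast this
      linarith
    calc η * (t / 2) ≤ η * ((t - N : ℕ) : ℝ) := by gcongr
      _ = ∑ τ ∈ Finset.Ico N t, η := by simp [mul_comm]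
      _ ≤ ∑ τ ∈ Finset.Ico N t, ∑ i, x i τ := Finset.sum_le_sum hbig
      _ ≤ _ := Finset.sum_le_sum_of_subset_of_nonneg
        (fun τ hτ => Finset.mem_range.mpr (Finset.mem_Ico.mp hτ).2)
        (fun τ _ _ => Finset.sum_nonneg fun i _ => h0 i τ)
  have hup : ∑ τ ∈ Finset.range t, ∑ i, x i τ ≤
      Fintype.card ι * (t * (η / (2 * (Fintype.card ι + 1)))) := by
    rw [Finset.sum_comm, ← nsmul_eq_mul, ← Finset.card_univ, ← Finset.sum_const]
    refine Finset.sum_le_sum fun i _ => ?_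
    have := (hT t (by omega) i).le
    rwa [one_div, inv_mul_le_iff₀ htpos] at this
  have hcard : (Fintype.card ι : ℝ) * (t * (η / (2 * (Fintype.card ι + 1)))) < η * (t / 2) := by
    have h : (0 : ℝ) < Fintype.card ι + 1 := by positivity
    have : η * (t / 2) - (Fintype.card ι : ℝ) * (t * (η / (2 * (Fintype.card ι + 1)))) =
        η * t / (2 * (Fintype.card ι + 1)) := by field_simp; ring
    have h2 : 0 < η * t / (2 * (Fintype.card ι + 1)) := by positivity
    linarith
  linarith

/-- The mean decisions of a stabilizing protocol up to a suitable late time serve the rates `lam` up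
to the error `η`. -/
lemma exists_sustainable_of_stabilizable {K : ℕ} {p : Fin K → ℝ} {q : ℝ} (hp : ∀ k, 0 ≤ p k)
    (hq : 0 ≤ q) {lam : Pair K → ℝ} (h : lam ∈ stabilizable p q) {η : ℝ} (hη : 0 < η) :
    ∃ f ∈ sustainable p, ∀ e, lam e ≤ q * f e + η := by
  obtain ⟨Ω, mΩ, μ, S, hμ, hM, hP, hS⟩ := h
  obtain ⟨M, hM0, hsq⟩ := hM.exists_sq_le
  -- Each of the three error terms of `mul_rate_le` is made at most `η / 3`: first the constant `c`
  -- is chosen, then the level `V`, then the late time `t`, which must serve all pairs at once.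
  obtain ⟨c, hc, hcM⟩ : ∃ c : ℝ, 0 < c ∧ c * M ≤ η / 3 := by
    refine ⟨η / 3 / (M + 1), by positivity, ?_⟩
    rw [div_mul_eq_mul_div, div_le_iff₀ (by positivity)]
    nlinarith
  set η' : ℝ := c * (η / 3) with hη'
  have hη'0 : 0 < η' := by positivity
  have hev : ∀ᶠ V : ℝ in atTop, ∀ e, limsup (fun t : ℕ => (1 / (t : ℝ)) *
      ∑ τ ∈ Finset.range t, μ.real {ω | V < (S.pending τ ω e : ℝ)}) atTop <
        η' / (2 * (Fintype.card (Pair K) + 1)) := by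
    rw [eventually_all]
    exact fun e => (hS e).eventually_lt_const (by positivity)
  obtain ⟨V, hV, hV0⟩ := (hev.and (eventually_ge_atTop 0)).exists
  obtain ⟨N, hN⟩ := exists_nat_ge (V / (η / 3))
  obtain ⟨t, htN, ht⟩ := exists_ge_forall_lt_of_limsup_average_lt
    (fun e τ => μ.real {ω | V < (S.pending τ ω e : ℝ)}) (fun _ _ => measureReal_nonneg)
    (fun _ _ => measureReal_le_one) hη'0 hV (N + 1)
  refine ⟨S.meanDecision μ t, Switch.meanDecision_mem_sustainable hp hM hP t, fun e => ?_⟩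
  have htpos : (0 : ℝ) < t := by
    have : 0 < t := by omega
    exact_mod_cast this
  have hVt : V ≤ t * (η / 3) := by
    rw [div_le_iff₀ (by positivity)] at hN
    have : (N : ℝ) ≤ t := by
      have : N ≤ t := by omega
      exact_mod_cast this
    nlinarith
  have hmain := Switch.mul_rate_le (e := e) hq hM hP hM0 hsq hc t V hV0
  have hPt : c⁻¹ * μ.real {ω | V < (S.pending t ω e : ℝ)} ≤ η / 3 := by
    rw [inv_mul_le_iff₀ hc]
    exact (ht e).le
  have h3 : (t : ℝ) * (c * M + c⁻¹ * μ.real {ω | V < (S.pending t ω e : ℝ)}) ≤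
      t * (η / 3 + η / 3) := by gcongr
  have : t * lam e ≤ t * (q * S.meanDecision μ t e + η) := by nlinarith
  exact le_of_mul_le_mul_left this htpos

/-- The capacity region lies below the sustainable rates of successful swapping operations. -/
lemma exists_sustainable_of_mem_capacityRegion {K : ℕ} {p : Fin K → ℝ} {q : ℝ}
    (hp : ∀ k, 0 ≤ p k) (hq : 0 ≤ q) {lam : Pair K → ℝ} (h : lam ∈ capacityRegion p q) :
    ∃ f ∈ sustainable p, ∀ e, lam e ≤ q * f e := by
  have happ : ∀ n : ℕ, ∃ f ∈ sustainable p, ∀ e, lam e ≤ q * f e + 2 * (1 / ((n : ℝ) + 1)) := by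
    intro n
    have hn : (0 : ℝ) < 1 / ((n : ℝ) + 1) := by positivity
    obtain ⟨lam', hlam', hd⟩ := Metric.mem_closure_iff.mp h _ hn
    obtain ⟨f, hf, hle⟩ := exists_sustainable_of_stabilizable hp hq hlam' hn
    refine ⟨f, hf, fun e => ?_⟩
    have h1 := (dist_le_pi_dist lam lam' e).trans hd.le
    rw [Real.dist_eq] at h1
    have h2 := (abs_le.mp h1).2
    have h3 := hle e
    linarith
  choose f hf hle using happ
  obtain ⟨g, hg, φ, hφ, hlim⟩ := (isCompact_sustainable p).tendsto_subseq hf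
  refine ⟨g, hg, fun e => ?_⟩
  have h1 : Tendsto (fun n => q * f (φ n) e + 2 * (1 / ((φ n : ℝ) + 1))) atTop
      (𝓝 (q * g e + 2 * 0)) :=
    (((continuous_apply e).tendsto g).comp hlim).const_mul q |>.add
      ((tendsto_one_div_add_atTop_nhds_zero_nat.comp hφ.tendsto_atTop).const_mul 2)
  simpa using ge_of_tendsto' h1 fun n => hle (φ n) e

/-! ### Repeated trials and the existence of periods -/

lemma isProbabilityMeasure_bernoulliLaw {x : ℝ} (h0 : 0 ≤ x) (h1 : x ≤ 1) :
    IsProbabilityMeasure (bernoulliLaw x) := by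
  constructor
  simp only [bernoulliLaw, Measure.add_apply, Measure.smul_apply, measure_univ, smul_eq_mul,
    mul_one]
  rw [← ENNReal.ofReal_add h0 (by linarith)]
  simp

/-- A probability law on `Bool` is determined by the probability of `true`. -/
lemma eq_bernoulliLaw {ν : Measure Bool} [IsProbabilityMeasure ν] {x : ℝ}
    (h : ν.real {true} = x) : ν = bernoulliLaw x := by
  have hfalse : ν.real {false} = 1 - x := by
    have : ({false} : Set Bool) = {true}ᶜ := by ext b; cases b <;> simp
    rw [this, probReal_compl_eq_one_sub (measurableSet_singleton _), h]
  refine Measure.ext_of_singleton fun b => ?_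
  cases b
  · rw [← ofReal_measureReal (μ := ν), hfalse]; simp [bernoulliLaw]
  · rw [← ofReal_measureReal (μ := ν), h]; simp [bernoulliLaw]

lemma isProbabilityMeasure_trialsLaw (n : ℕ) {x : ℝ} (h0 : 0 ≤ x) (h1 : x ≤ 1) :
    IsProbabilityMeasure (trialsLaw n x) := by
  have := isProbabilityMeasure_bernoulliLaw h0 h1
  unfold trialsLaw; infer_instance

/-- Chebyshev's inequality for the number of successes. -/
lemma trialsLaw_successCount_lt_le {n : ℕ} (hn : 0 < n) {x : ℝ} (h0 : 0 ≤ x) (h1 : x ≤ 1)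
    {ε : ℝ} (hε : 0 < ε) :
    (trialsLaw n x).real {w | (successCount w : ℝ) < n * (x - ε / 2)} ≤ 1 / (n * ε ^ 2) := by
  have hb := isProbabilityMeasure_bernoulliLaw h0 h1
  have ht := isProbabilityMeasure_trialsLaw n h0 h1
  have hn' : (0 : ℝ) < n := by exact_mod_cast hn
  set φ : Bool → ℝ := fun b => if b = true then 1 else 0 with hφ
  have hφm : Measurable φ := measurable_of_countable φ
  set X : Fin n → (Fin n → Bool) → ℝ := fun τ w => φ (w τ) with hX
  have hXm : ∀ τ, Measurable (X τ) := fun τ => hφm.comp (measurable_pi_apply τ)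
  have hX01 : ∀ τ w, X τ w ∈ Set.Icc (0 : ℝ) 1 := by
    intro τ w
    simp only [hX, hφ]
    split_ifs <;> simp
  have hL2 : ∀ τ, MemLp (X τ) 2 (trialsLaw n x) := fun τ =>
    memLp_of_bounded (ae_of_all _ (hX01 τ)) (hXm τ).aestronglyMeasurable 2
  have hmean : ∀ τ, ∫ w, X τ w ∂(trialsLaw n x) = x := by
    intro τ
    have h2 := (measurePreserving_eval (fun _ : Fin n => bernoulliLaw x) τ).map_eq
    have h3 : ∫ w, X τ w ∂(trialsLaw n x) = ∫ b, φ b ∂(bernoulliLaw x) := by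
      conv_rhs => rw [← h2]
      rw [integral_map (measurable_pi_apply τ).aemeasurable hφm.aestronglyMeasurable]
      rfl
    rw [h3, integral_fintype (Integrable.of_finite)]
    simp [hφ, bernoulliLaw, measureReal_def, h0]
  have hcount : ∀ w : Fin n → Bool, (successCount w : ℝ) = (∑ τ, X τ) w := by
    intro w
    simp [successCount, hX, hφ]
  have hvar : Var[∑ τ, X τ; trialsLaw n x] ≤ n / 4 := by
    have hind : iIndepFun X (trialsLaw n x) :=
      iIndepFun_pi (μ := fun _ : Fin n => bernoulliLaw x) (X := fun _ => φ)
        fun _ => hφm.aemeasurable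
    rw [IndepFun.variance_sum (fun τ _ => hL2 τ) (fun i _ j _ hij => hind.indepFun hij)]
    calc ∑ τ, Var[X τ; trialsLaw n x] ≤ ∑ _τ : Fin n, ((1 - 0) / 2 : ℝ) ^ 2 :=
          Finset.sum_le_sum fun τ _ =>
            variance_le_sq_of_bounded (ae_of_all _ (hX01 τ)) (hXm τ).aemeasurable
      _ = n / 4 := by simp; ring
  have hint : ∫ w, (∑ τ, X τ) w ∂(trialsLaw n x) = n * x := by
    simp only [Finset.sum_apply]
    rw [integral_finsetSum _ fun τ _ => (hL2 τ).integrable (by norm_num)]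
    simp [hmean]
  have hcheb := meas_ge_le_variance_div_sq (memLp_finsetSum' Finset.univ fun τ _ => hL2 τ)
    (c := n * (ε / 2)) (by positivity)
  have hsub : {w | (successCount w : ℝ) < n * (x - ε / 2)} ⊆
      {w | n * (ε / 2) ≤ |(∑ τ, X τ) w - ∫ w, (∑ τ, X τ) w ∂(trialsLaw n x)|} := by
    intro w hw
    simp only [Set.mem_ofPred_eq, hcount, hint] at hw ⊢
    rw [abs_sub_comm]
    refine le_trans ?_ (le_abs_self _)
    linarith
  refine (ENNReal.toReal_mono ENNReal.ofReal_ne_top ((measure_mono hsub).trans hcheb)).trans ?_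
  rw [ENNReal.toReal_ofReal (div_nonneg (variance_nonneg _ _) (sq_nonneg _)),
    div_le_div_iff₀ (by positivity) (by positivity)]
  have : Var[∑ τ, X τ; trialsLaw n x] * (n * ε ^ 2) ≤ n / 4 * (n * ε ^ 2) := by gcongr
  linarith [this, show (n : ℝ) / 4 * (n * ε ^ 2) = 1 * (n * (ε / 2)) ^ 2 by ring]

/-- Sustainable swapping rates for `lam + ε` leave the room `ε / 4` for the tolerance
`δ = ε / 8`; long periods satisfy the condition on the trials by Chebyshev's inequality. -/
lemma exists_isPeriod {K : ℕ} {p : Fin K → ℝ} {q : ℝ} (hp : ∀ k, 0 ≤ p k ∧ p k ≤ 1)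
    (hq : 0 ≤ q ∧ q ≤ 1) {lam : Pair K → ℝ} {ε : ℝ} (hε : 0 < ε)
    (hΛ : (fun e => lam e + ε) ∈ capacityRegion p q) :
    ∃ (f : Pair K → ℝ) (δ : ℝ) (N : ℕ), ∀ T₀, N ≤ T₀ → IsPeriod p q lam ε f δ T₀ := by
  obtain ⟨f, hf, hle⟩ := exists_sustainable_of_mem_capacityRegion (fun k => (hp k).1) hq.1 hΛ
  have hf1 : ∀ e, f e ≤ 1 := fun e => by
    induction e using Sym2.ind with
    | _ i j => exact (le_of_mem_sustainable hf i j).trans (hp j).2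
  obtain ⟨N, hN⟩ := exists_nat_ge (2 / (ε ^ 2 * (ε / 8)))
  refine ⟨f, ε / 8, N + 1, fun T₀ hT => ⟨hf.1, hf.2, hle, by positivity, fun e => ?_, by omega,
    fun e => ?_⟩⟩
  · have h1 := hle e
    have h2 := hf1 e
    have h3 : q * (f e - ε / 2) ≤ 1 := by nlinarith [hf.1 e, hq.1, hq.2]
    have h4 : q * (ε / 2) ≤ ε / 2 := by nlinarith [hq.2]
    nlinarith
  · have ht := isProbabilityMeasure_trialsLaw T₀ (hf.1 e) (hf1 e)
    have hTpos : 0 < T₀ := by omega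
    have hTpos' : (0 : ℝ) < T₀ := by exact_mod_cast hTpos
    set A : Set (Fin T₀ → Bool) := {w | (successCount w : ℝ) < T₀ * (f e - ε / 2)} with hA
    have hsub : {w : (Fin T₀ → Bool) × (Fin T₀ → Bool) |
        ((min (successCount w.1) (successCount w.2) : ℕ) : ℝ) < T₀ * (f e - ε / 2)} ⊆
        A ×ˢ Set.univ ∪ Set.univ ×ˢ A := by
      intro w hw
      simp only [Set.mem_ofPred_eq, Nat.cast_min, min_lt_iff] at hw
      simpa [hA] using hw
    refine (measureReal_mono hsub).trans ((measureReal_union_le _ _).trans ?_)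
    rw [measureReal_prod_prod, measureReal_prod_prod, probReal_univ, mul_one, one_mul]
    have hch := trialsLaw_successCount_lt_le hTpos (hf.1 e) (hf1 e) hε
    have hT2 : 2 / (T₀ * ε ^ 2) ≤ ε / 8 := by
      have hNT : (N : ℝ) ≤ T₀ := by
        have : N ≤ T₀ := by omega
        exact_mod_cast this
      rw [div_le_iff₀ (by positivity)] at hN ⊢
      have : (N : ℝ) * (ε ^ 2 * (ε / 8)) ≤ T₀ * (ε ^ 2 * (ε / 8)) := by gcongr
      linarith
    calc _ ≤ 1 / (T₀ * ε ^ 2) + 1 / (T₀ * ε ^ 2) := add_le_add hch hch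
      _ = 2 / (T₀ * ε ^ 2) := by ring
      _ ≤ _ := hT2

/-! ### Pathwise estimates for max weight protocols -/

/-- Truncating an optimal solution `F` at `T` costs nothing against competitors `G` that use at
most `T` link pairs per node: exchanging `min F T` for `G` in `F` is feasible, since at each node
either `F` is not truncated at all or `min F T` uses at least `T` link pairs. -/
lemma sum_mul_le_sum_mul_min {K : ℕ} {w F G : Pair K → ℕ} {c : Fin K → ℕ} {T : ℕ}
    (hF : ∀ j, ∑ i, F s(i, j) ≤ c j)
    (hopt : ∀ F' : Pair K → ℕ, (∀ j, ∑ i, F' s(i, j) ≤ c j) →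
      ∑ i, ∑ j, w s(i, j) * F' s(i, j) ≤ ∑ i, ∑ j, w s(i, j) * F s(i, j))
    (hG : ∀ j, ∑ i, G s(i, j) ≤ c j) (hGT : ∀ j, ∑ i, G s(i, j) ≤ T) :
    ∑ i, ∑ j, w s(i, j) * G s(i, j) ≤ ∑ i, ∑ j, w s(i, j) * min (F s(i, j)) T := by
  have hfeas : ∀ j, ∑ i, ((F s(i, j) - min (F s(i, j)) T) + G s(i, j)) ≤ c j := by
    intro j
    by_cases hj : ∃ i, T < F s(i, j)
    · obtain ⟨i, hi⟩ := hj
      have h1 : T ≤ ∑ i, min (F s(i, j)) T := by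
        refine le_trans ?_ (Finset.single_le_sum (f := fun i => min (F s(i, j)) T)
          (fun _ _ => Nat.zero_le _) (Finset.mem_univ i))
        simp [hi.le]
      have h2 : ∑ i, (F s(i, j) - min (F s(i, j)) T) + ∑ i, min (F s(i, j)) T =
          ∑ i, F s(i, j) := by
        rw [← Finset.sum_add_distrib]
        exact Finset.sum_congr rfl fun i _ => by omega
      have := hF j
      have := hGT j
      rw [Finset.sum_add_distrib]
      omega
    · push Not at hj
      have h0 : ∀ i, F s(i, j) - min (F s(i, j)) T = 0 := fun i => by
        have := hj i
        omega
      simpa [h0] using hG j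
  have h1 := hopt (fun e => (F e - min (F e) T) + G e) hfeas
  have h2 : ∑ i, ∑ j, w s(i, j) * ((F s(i, j) - min (F s(i, j)) T) + G s(i, j)) +
      ∑ i, ∑ j, w s(i, j) * min (F s(i, j)) T =
      ∑ i, ∑ j, w s(i, j) * F s(i, j) + ∑ i, ∑ j, w s(i, j) * G s(i, j) := by
    simp only [← Finset.sum_add_distrib, ← mul_add]
    refine Finset.sum_congr rfl fun i _ => Finset.sum_congr rfl fun j _ => ?_
    congr 1
    omega
  omega

/-- One step of a queue that evolves from `x` to `y` while at most `r ≤ T` requests are served and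
`a` requests arrive.  A larger decrease of the queue, which may make the weight `x` obsolete for
the next decision, is paid for by the decrease of the square. -/
lemma sq_add_two_mul_sub_le {T x y r a : ℕ} (hr : r ≤ T) (hy : y ≤ (x - r) + a) :
    y ^ 2 + 2 * T * (x - y) + 2 * (x * r) ≤ x ^ 2 + 2 * (x * a) + a ^ 2 + 4 * T ^ 2 := by
  have hcast : ((x - y : ℕ) : ℤ) = max ((x : ℤ) - y) 0 := by omega
  have hy' : (y : ℤ) ≤ max ((x : ℤ) - r) 0 + a := by omega
  have hr' : (r : ℤ) ≤ T := by exact_mod_cast hr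
  zify
  rw [hcast]
  have hx0 : (0 : ℤ) ≤ x := by positivity
  have hy0 : (0 : ℤ) ≤ y := by positivity
  have hr0 : (0 : ℤ) ≤ r := by positivity
  have ha0 : (0 : ℤ) ≤ a := by positivity
  have hT0 : (0 : ℤ) ≤ T := by positivity
  generalize (x : ℤ) = x at *
  generalize (y : ℤ) = y at *
  generalize (r : ℤ) = r at *
  generalize (a : ℤ) = a at *
  generalize (T : ℤ) = T at *
  have hrT : r ^ 2 ≤ T ^ 2 := by nlinarith
  have hxa := mul_nonneg hx0 ha0
  rcases le_total x r with hxr | hrx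
  · rw [max_eq_right (by linarith), zero_add] at hy'
    have h1 : y ^ 2 ≤ a ^ 2 := by nlinarith
    have h2 : x * r ≤ T * T := mul_le_mul (hxr.trans hr') hr' hr0 hT0
    have h3 : T * max (x - y) 0 ≤ T * T :=
      mul_le_mul_of_nonneg_left (max_le (by linarith) hT0) hT0
    nlinarith
  · rw [max_eq_left (by linarith)] at hy'
    have hra := mul_nonneg hr0 ha0
    have hY : (x - r + a) ^ 2 ≤ x ^ 2 - 2 * (x * r) + r ^ 2 + 2 * (x * a) + a ^ 2 := by
      nlinarith
    rcases le_total x y with hxy | hyx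
    · rw [max_eq_right (by linarith)]
      have : y ^ 2 ≤ (x - r + a) ^ 2 := by nlinarith
      nlinarith
    · rw [max_eq_left (by linarith)]
      rcases le_total y (2 * T) with hyT | hyT
      · have h1 : y * (y - 2 * T) ≤ 0 := mul_nonpos_of_nonneg_of_nonpos hy0 (by linarith)
        have h2 : x * r ≤ x * T := mul_le_mul_of_nonneg_left hr' hx0
        nlinarith [sq_nonneg (x - 2 * T), sq_nonneg a]
      · have h1 : y * (y - 2 * T) ≤ (x - r + a) * ((x - r + a) - 2 * T) :=
          mul_le_mul hy' (by linarith) (by linarith) (by linarith)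
        have h2 : T * (x - (x - r + a)) ≤ T * T :=
          mul_le_mul_of_nonneg_left (by linarith) hT0
        nlinarith

/-- The drift of `y² + 2 T [x - y]⁺`, where the queue has successive lengths `z`, `x`, `y` and the
weight of its service `r` is the outdated length `z`. -/
lemma sq_add_two_mul_sub_add_le {T z x y r a : ℕ} (hr : r ≤ T) (hy : y ≤ (x - r) + a) :
    (y ^ 2 + 2 * T * (x - y)) + 2 * (z * r) ≤
      (x ^ 2 + 2 * T * (z - x)) + 2 * (x * a) + a ^ 2 + 4 * T ^ 2 := by
  have h1 := sq_add_two_mul_sub_le hr hy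
  have h2 : z * r ≤ x * r + T * (z - x) :=
    calc z * r ≤ (x + (z - x)) * r := Nat.mul_le_mul_right _ (by omega)
      _ = x * r + r * (z - x) := by ring
      _ ≤ x * r + T * (z - x) := by gcongr
  linarith

namespace Switch

variable {K : ℕ} {Ω : Type*} {S : Switch K Ω}

/-- Until the next decision, at least the link pairs created since the last one are stored. -/
lemma IsMaxWeight.sum_newLinks_le_link {T₀ : ℕ} (hW : S.IsMaxWeight T₀) {s : ℕ}
    (hs : T₀ ∣ s + 1) {k : ℕ} (hk : k < T₀) (ω : Ω) (j : Fin K) :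
    ∑ τ ∈ Finset.range (k + 1), S.newLinks (s + τ) ω j ≤ S.link (s + (k + 1)) ω j := by
  have hstep : ∀ t, S.link (t + 1) ω j =
      (S.link t ω j - ∑ i, S.decision t ω s(i, j)) + S.newLinks t ω j := fun _ => rfl
  induction k with
  | zero => simp [hstep]
  | succ k ih =>
    have hndvd : ¬ T₀ ∣ s + (k + 1) + 1 := by
      intro h
      have h2 : T₀ ∣ k + 1 := by
        have h3 : s + (k + 1) + 1 = (s + 1) + (k + 1) := by omega
        rw [h3] at h
        exact (Nat.dvd_add_right hs).mp h
      exact absurd (Nat.le_of_dvd (by omega) h2) (by omega)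
    have h0 : ∑ i, S.decision (s + (k + 1)) ω s(i, j) = 0 :=
      Finset.sum_eq_zero fun i _ => hW.idle _ hndvd ω _
    have := ih (by omega)
    rw [Finset.sum_range_succ, ← add_assoc s (k + 1) 1, hstep, h0]
    omega

lemma pending_succ_le (S : Switch K Ω) (t : ℕ) (ω : Ω) (e : Pair K) :
    S.pending (t + 1) ω e ≤ (S.pending t ω e - S.swapped t ω e) + S.requests t ω e := by
  have : S.pending (t + 1) ω e =
    (S.pending t ω e - (S.stored t ω e + S.swapped t ω e)) + S.requests t ω e := rfl
  omega

lemma pending_add_le (S : Switch K Ω) (t k : ℕ) (ω : Ω) (e : Pair K) :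
    S.pending (t + (k + 1)) ω e ≤ (S.pending t ω e - S.swapped t ω e) +
      ∑ τ ∈ Finset.range (k + 1), S.requests (t + τ) ω e := by
  induction k with
  | zero => simpa using S.pending_succ_le t ω e
  | succ k ih =>
    have := S.pending_succ_le (t + (k + 1)) ω e
    rw [Finset.sum_range_succ, ← add_assoc t (k + 1) 1]
    omega

/-- The number of requests in the `T` slots from `t` on. -/
def arrivals (S : Switch K Ω) (t T : ℕ) (ω : Ω) (e : Pair K) : ℕ :=
  ∑ τ ∈ Finset.range T, S.requests (t + τ) ω e

/-- The number of successes among the first `T` of the swapping operations of slot `t`. -/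
def cappedSwaps (S : Switch K Ω) (t T : ℕ) (ω : Ω) (e : Pair K) : ℕ :=
  S.successes t e (min (S.decision t ω e) T) ω

lemma pending_add_le_capped (S : Switch K Ω) (t : ℕ) {T : ℕ} (hT : 0 < T) (ω : Ω) (e : Pair K) :
    S.pending (t + T) ω e ≤
      (S.pending t ω e - S.cappedSwaps t T ω e) + S.arrivals t T ω e := by
  obtain ⟨k, rfl⟩ : ∃ k, T = k + 1 := ⟨T - 1, by omega⟩
  have h1 := S.pending_add_le t k ω e
  have h2 : S.cappedSwaps t (k + 1) ω e ≤ S.swapped t ω e :=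
    S.successes_mono t e ω (min_le_left _ _)
  unfold arrivals
  omega

lemma pending_add_le_add_arrivals (S : Switch K Ω) (t T : ℕ) (ω : Ω) (e : Pair K) :
    S.pending (t + T) ω e ≤ S.pending t ω e + S.arrivals t T ω e := by
  rcases Nat.eq_zero_or_pos T with rfl | hT
  · simp [arrivals]
  · have := S.pending_add_le_capped t hT ω e
    omega

/-- The Lyapunov function of the two queue lengths at the distance of one period, summed over ordered
pairs of nodes as in the objective of the integer program.  Its second term pays for the use of
outdated weights: the decision of slot `t + 2 T` maximizes with respect to the queues of slot
`t + T`, but serves those that are left in slot `t + 2 T`. -/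
def lyapunov (S : Switch K Ω) (T t : ℕ) (ω : Ω) : ℕ :=
  ∑ i, ∑ j, (S.pending (t + T) ω s(i, j) ^ 2 +
    2 * T * (S.pending t ω s(i, j) - S.pending (t + T) ω s(i, j)))

lemma lyapunov_add_le (S : Switch K Ω) (t : ℕ) {T : ℕ} (hT : 0 < T) (ω : Ω) :
    S.lyapunov T (t + T) ω +
      2 * ∑ i, ∑ j, S.pending t ω s(i, j) * S.cappedSwaps (t + T) T ω s(i, j) ≤
    S.lyapunov T t ω + ∑ i, ∑ j, (2 * (S.pending (t + T) ω s(i, j) *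
      S.arrivals (t + T) T ω s(i, j)) + S.arrivals (t + T) T ω s(i, j) ^ 2 + 4 * T ^ 2) := by
  simp only [lyapunov, Finset.mul_sum, ← Finset.sum_add_distrib]
  refine Finset.sum_le_sum fun i _ => Finset.sum_le_sum fun j _ => ?_
  have := sq_add_two_mul_sub_add_le (z := S.pending t ω s(i, j))
    (show S.cappedSwaps (t + T) T ω s(i, j) ≤ T from
      (S.successes_le _ _ _ _).trans (min_le_right _ _))
    (S.pending_add_le_capped (t + T) hT ω s(i, j))
  linarith

end Switch

/-- The largest weight `∑ w_ij F_ij` of a choice of swapping operations `F` that uses, at each node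
`j`, at most as many link pairs as there are successes in `c j`.  The bound `F_ij ≤ T`, which
follows from this condition, makes the set of candidates a `Finset`. -/
def maxWeight {K T : ℕ} (w : Pair K → ℕ) (c : Fin K → Fin T → Bool) : ℕ :=
  ((Fintype.piFinset fun _ : Pair K => Finset.range (T + 1)).filter
    fun F => ∀ j, ∑ i, F s(i, j) ≤ successCount (c j)).sup
      fun F => ∑ i, ∑ j, w s(i, j) * F s(i, j)

lemma successCount_le {n : ℕ} (w : Fin n → Bool) : successCount w ≤ n :=
  (Finset.card_filter_le _ _).trans_eq (by simp)

lemma le_maxWeight {K T : ℕ} (w : Pair K → ℕ) {c : Fin K → Fin T → Bool} {F : Pair K → ℕ}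
    (hF : ∀ j, ∑ i, F s(i, j) ≤ successCount (c j)) :
    ∑ i, ∑ j, w s(i, j) * F s(i, j) ≤ maxWeight w c := by
  refine Finset.le_sup (f := fun F : Pair K → ℕ => ∑ i, ∑ j, w s(i, j) * F s(i, j)) ?_
  refine Finset.mem_filter.mpr ⟨Fintype.mem_piFinset.mpr fun e => ?_, hF⟩
  induction e using Sym2.ind with
  | _ i j =>
    have h1 := Finset.single_le_sum (f := fun i => F s(i, j)) (fun _ _ => Nat.zero_le _)
      (Finset.mem_univ i)
    have h2 := hF j
    have h3 := successCount_le (c j)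
    simp only [Finset.mem_range] at h1 ⊢
    omega

namespace Switch

variable {K : ℕ} {Ω : Type*} {S : Switch K Ω}

/-- The creation attempts at each node in the `T` slots from `t` on. -/
def linkBlock (S : Switch K Ω) (t T : ℕ) (ω : Ω) : Fin K → Fin T → Bool :=
  fun j τ => S.generated (t + τ) ω j

lemma successCount_linkBlock (S : Switch K Ω) (t T : ℕ) (ω : Ω) (j : Fin K) :
    successCount (S.linkBlock t T ω j) = ∑ τ ∈ Finset.range T, S.newLinks (t + τ) ω j := by
  rw [← Fin.sum_univ_eq_sum_range (fun τ => S.newLinks (t + τ) ω j), successCount,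
    Finset.card_filter]
  refine Finset.sum_congr rfl fun τ _ => ?_
  cases h : S.generated (t + τ) ω j <;> simp [linkBlock, newLinks, h]

lemma IsMaxWeight.maxWeight_le {T₀ : ℕ} (hP : S.IsProtocol) (hW : S.IsMaxWeight T₀)
    (hT : 0 < T₀) {s : ℕ} (hs : T₀ ∣ s + 1) (ω : Ω) :
    maxWeight (S.pending s ω) (S.linkBlock s T₀ ω) ≤
      ∑ i, ∑ j, S.pending s ω s(i, j) * min (S.decision (s + T₀) ω s(i, j)) T₀ := by
  refine Finset.sup_le fun F hF => ?_
  have hF' := (Finset.mem_filter.mp hF).2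
  have hopt := hW.optimal (s + T₀) (by
    have : s + T₀ + 1 = (s + 1) + T₀ := by omega
    rw [this]; exact dvd_add hs dvd_rfl) ω
  rw [Nat.add_sub_cancel] at hopt
  refine sum_mul_le_sum_mul_min (hP.feasible _ ω) hopt (fun j => (hF' j).trans ?_)
    fun j => (hF' j).trans (successCount_le _)
  rw [S.successCount_linkBlock]
  obtain ⟨k, rfl⟩ : ∃ k, T₀ = k + 1 := ⟨T₀ - 1, by omega⟩
  exact hW.sum_newLinks_le_link hs (by omega) ω j

end Switch

/-! ### Random allotment of link pairs to partners -/

instance {α β : Type*} [MeasurableSpace α] [MeasurableSpace β] [MeasurableSingletonClass α]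
    [MeasurableSingletonClass β] : MeasurableSingletonClass (α ⊕ β) where
  measurableSet_singleton x := by
    rw [measurableSet_sum_iff]
    rcases x with a | b
    · exact ⟨(Set.subsingleton_singleton.preimage Sum.inl_injective).measurableSet,
        (Set.subsingleton_singleton.preimage Sum.inr_injective).measurableSet⟩
    · exact ⟨(Set.subsingleton_singleton.preimage Sum.inl_injective).measurableSet,
        (Set.subsingleton_singleton.preimage Sum.inr_injective).measurableSet⟩

/-- The law of one creation attempt that succeeds with probability `x`, together with the
partner to which the new link pair is allotted: `inl i` is a link pair reserved for swapping with
node `i`, which has probability `g i`, `inr true` is a link pair reserved for nobody, and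
`inr false` is a failure. -/
noncomputable def allotmentLaw {K : ℕ} (g : Fin K → ℝ) (x : ℝ) : Measure (Fin K ⊕ Bool) :=
  ∑ i, ENNReal.ofReal (g i) • Measure.dirac (Sum.inl i) +
    (ENNReal.ofReal (x - ∑ i, g i) • Measure.dirac (Sum.inr true) +
      ENNReal.ofReal (1 - x) • Measure.dirac (Sum.inr false))

/-- Whether a link pair was created. -/
def isLink {K : ℕ} : Fin K ⊕ Bool → Bool := Sum.elim (fun _ => true) id

/-- Whether a link pair was created and allotted to the partner `i`. -/
def isAllotted {K : ℕ} (i : Fin K) (z : Fin K ⊕ Bool) : Bool := decide (z = Sum.inl i)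

section

variable {K : ℕ} {g : Fin K → ℝ} {x : ℝ}

lemma isProbabilityMeasure_allotmentLaw (hg : ∀ i, 0 ≤ g i) (hgx : ∑ i, g i ≤ x) (hx : x ≤ 1) :
    IsProbabilityMeasure (allotmentLaw g x) := by
  constructor
  have h0 : 0 ≤ ∑ i, g i := Finset.sum_nonneg fun i _ => hg i
  simp only [allotmentLaw, Measure.add_apply, Measure.finsetSum_apply, Measure.smul_apply,
    measure_univ, smul_eq_mul, mul_one]
  rw [← ENNReal.ofReal_sum_of_nonneg fun i _ => hg i,
    ← ENNReal.ofReal_add (by linarith) (by linarith), ← ENNReal.ofReal_add h0 (by linarith)]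
  simp

lemma map_isLink_allotmentLaw (hg : ∀ i, 0 ≤ g i) (hgx : ∑ i, g i ≤ x) (hx : x ≤ 1) :
    (allotmentLaw g x).map isLink = bernoulliLaw x := by
  have := isProbabilityMeasure_allotmentLaw hg hgx hx
  have hm : Measurable (isLink (K := K)) := measurable_of_countable _
  have := Measure.isProbabilityMeasure_map (μ := allotmentLaw g x) hm.aemeasurable
  have h0 : 0 ≤ ∑ i, g i := Finset.sum_nonneg fun i _ => hg i
  refine eq_bernoulliLaw ?_
  have h : (allotmentLaw g x).map isLink {true} = ENNReal.ofReal x := by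
    rw [Measure.map_apply hm (measurableSet_singleton _)]
    simp only [allotmentLaw, Measure.add_apply, Measure.finsetSum_apply, Measure.smul_apply,
      smul_eq_mul, Measure.dirac_apply, Set.indicator, isLink]
    simp [← ENNReal.ofReal_sum_of_nonneg fun i _ => hg i,
      ← ENNReal.ofReal_add h0 (sub_nonneg.mpr hgx)]
  rw [measureReal_def, h, ENNReal.toReal_ofReal (h0.trans hgx)]

lemma map_isAllotted_allotmentLaw (hg : ∀ i, 0 ≤ g i) (hgx : ∑ i, g i ≤ x) (hx : x ≤ 1)
    (i : Fin K) : (allotmentLaw g x).map (isAllotted i) = bernoulliLaw (g i) := by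
  have := isProbabilityMeasure_allotmentLaw hg hgx hx
  have hm : Measurable (isAllotted i) := measurable_of_countable _
  have := Measure.isProbabilityMeasure_map (μ := allotmentLaw g x) hm.aemeasurable
  refine eq_bernoulliLaw ?_
  have h : (allotmentLaw g x).map (isAllotted i) {true} = ENNReal.ofReal (g i) := by
    rw [Measure.map_apply hm (measurableSet_singleton _)]
    simp [allotmentLaw, Set.indicator, isAllotted]
  rw [measureReal_def, h, ENNReal.toReal_ofReal (hg i)]

end

/-- The number of swapping operations for each pair that use only link pairs allotted to each
other. -/
def allottedSwaps {K T : ℕ} (z : Fin K → Fin T → Fin K ⊕ Bool) : Pair K → ℕ :=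
  Sym2.lift ⟨fun i j => min (successCount fun τ => isAllotted i (z j τ))
    (successCount fun τ => isAllotted j (z i τ)), fun _ _ => min_comm _ _⟩

lemma sum_allottedSwaps_le {K T : ℕ} (z : Fin K → Fin T → Fin K ⊕ Bool) (j : Fin K) :
    ∑ i, allottedSwaps z s(i, j) ≤ successCount fun τ => isLink (z j τ) := by
  refine (Finset.sum_le_sum (g := fun i => successCount fun τ => isAllotted i (z j τ))
    fun i _ => min_le_left _ _).trans ?_
  simp only [successCount, Finset.card_filter]
  rw [Finset.sum_comm]
  refine Finset.sum_le_sum fun τ _ => ?_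
  rcases z j τ with i | b
  · simp [isAllotted, isLink]
  · simp [isAllotted]

section

variable {K : ℕ} {p : Fin K → ℝ} {f : Pair K → ℝ} {T : ℕ}

/-- The joint law of all creation attempts and allotments during `T` slots. -/
noncomputable def allotmentsLaw (p : Fin K → ℝ) (f : Pair K → ℝ) (T : ℕ) :
    Measure (Fin K → Fin T → Fin K ⊕ Bool) :=
  Measure.pi fun j => Measure.pi fun _ : Fin T => allotmentLaw (fun i => f s(i, j)) (p j)

lemma map_isLink_allotmentsLaw (hf : f ∈ sustainable p) (hp : ∀ k, p k ≤ 1) :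
    (allotmentsLaw p f T).map (fun z j τ => isLink (z j τ)) =
      Measure.pi fun j => trialsLaw T (p j) := by
  have hpr := fun j => isProbabilityMeasure_allotmentLaw (fun i => hf.1 s(i, j)) (hf.2 j) (hp j)
  have hm : Measurable (isLink (K := K)) := measurable_of_countable _
  have hpr2 := fun j => Measure.isProbabilityMeasure_map
    (μ := allotmentLaw (fun i => f s(i, j)) (p j)) hm.aemeasurable
  have hin : ∀ j, (Measure.pi fun _ : Fin T => allotmentLaw (fun i => f s(i, j)) (p j)).map
      (fun (y : Fin T → Fin K ⊕ Bool) τ => isLink (y τ)) = trialsLaw T (p j) := fun j => by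
    rw [Measure.pi_map_pi fun _ => hm.aemeasurable]
    simp only [map_isLink_allotmentLaw (fun i => hf.1 s(i, j)) (hf.2 j) (hp j)]
    rfl
  have hm2 : Measurable fun (y : Fin T → Fin K ⊕ Bool) τ => isLink (y τ) :=
    measurable_of_countable _
  have hpr3 := fun j => Measure.isProbabilityMeasure_map
    (μ := Measure.pi fun _ : Fin T => allotmentLaw (fun i => f s(i, j)) (p j)) hm2.aemeasurable
  rw [allotmentsLaw, Measure.pi_map_pi (f := fun _ (y : Fin T → Fin K ⊕ Bool) τ => isLink (y τ))
    fun _ => hm2.aemeasurable]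
  simp only [hin]

lemma isProbabilityMeasure_allotmentsLaw (hf : f ∈ sustainable p) (hp : ∀ k, p k ≤ 1) :
    IsProbabilityMeasure (allotmentsLaw p f T) := by
  have hpr := fun j => isProbabilityMeasure_allotmentLaw (fun i => hf.1 s(i, j)) (hf.2 j) (hp j)
  unfold allotmentsLaw
  infer_instance

/-- The link pairs of node `j` that are allotted to node `i` are successes in a series of
independent trials. -/
lemma map_isAllotted_allotmentsLaw (hf : f ∈ sustainable p) (hp : ∀ k, p k ≤ 1) (i j : Fin K) :
    (allotmentsLaw p f T).map (fun z τ => isAllotted i (z j τ)) = trialsLaw T (f s(i, j)) := by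
  have hpr := fun j => isProbabilityMeasure_allotmentLaw (fun i => hf.1 s(i, j)) (hf.2 j) (hp j)
  have hm : Measurable (isAllotted i) := measurable_of_countable _
  have hpr2 := Measure.isProbabilityMeasure_map
    (μ := allotmentLaw (fun i => f s(i, j)) (p j)) hm.aemeasurable
  have hm2 : Measurable fun (y : Fin T → Fin K ⊕ Bool) τ => isAllotted i (y τ) :=
    measurable_of_countable _
  have h := (measurePreserving_eval (fun j => Measure.pi fun _ : Fin T =>
    allotmentLaw (fun i => f s(i, j)) (p j)) j).map_eq
  have hcomp : (fun (z : Fin K → Fin T → Fin K ⊕ Bool) τ => isAllotted i (z j τ)) =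
    (fun (y : Fin T → Fin K ⊕ Bool) τ => isAllotted i (y τ)) ∘ Function.eval j := rfl
  rw [hcomp, ← Measure.map_map hm2 (measurable_pi_apply j), allotmentsLaw, h,
    Measure.pi_map_pi fun _ => hm.aemeasurable]
  simp only [map_isAllotted_allotmentLaw (fun i => hf.1 s(i, j)) (hf.2 j) (hp j)]
  rfl

lemma allottedSwaps_lt_le (hf : f ∈ sustainable p) (hp : ∀ k, p k ≤ 1) {δ x : ℝ} (e : Pair K)
    (h : ((trialsLaw T (f e)).prod (trialsLaw T (f e))).real
      {w | ((min (successCount w.1) (successCount w.2) : ℕ) : ℝ) < x} ≤ δ) :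
    (allotmentsLaw p f T).real {z | (allottedSwaps z e : ℝ) < x} ≤ δ := by
  have hpr := isProbabilityMeasure_allotmentsLaw (T := T) hf hp
  induction e using Sym2.ind with
  | _ i j =>
    have hm : ∀ i j : Fin K, Measurable
        fun (z : Fin K → Fin T → Fin K ⊕ Bool) τ => isAllotted i (z j τ) :=
      fun i j => measurable_of_countable _
    have hlaw := map_isAllotted_allotmentsLaw (T := T) hf hp
    -- A swapping operation for `{j, j}` consumes one link pair, so on the diagonal the minimum is a
    -- single number of successes.
    by_cases hij : i = j
    · subst hij
      refine le_trans ?_ h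
      have hpr' : IsProbabilityMeasure (trialsLaw T (f s(i, i))) := by
        rw [← hlaw i i]; exact Measure.isProbabilityMeasure_map (hm i i).aemeasurable
      have h1 : (allotmentsLaw p f T).real {z | (allottedSwaps z s(i, i) : ℝ) < x} =
          (trialsLaw T (f s(i, i))).real {w | (successCount w : ℝ) < x} := by
        rw [← hlaw i i, map_measureReal_apply (hm i i) (Set.to_countable _).measurableSet]
        congr 1
        ext z
        simp [allottedSwaps]
      rw [h1, ← mul_one ((trialsLaw T (f s(i, i))).real _),
        ← probReal_univ (μ := trialsLaw T (f s(i, i))), ← measureReal_prod_prod]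
      refine measureReal_mono fun w hw => ?_
      have hw1 : (successCount w.1 : ℝ) < x := hw.1
      exact lt_of_le_of_lt (Nat.cast_le.mpr (min_le_left _ _)) hw1
    · have hprj := fun j => isProbabilityMeasure_allotmentLaw
        (fun i => hf.1 s(i, j)) (hf.2 j) (hp j)
      have hind : IndepFun (fun (z : Fin K → Fin T → Fin K ⊕ Bool) τ => isAllotted i (z j τ))
          (fun z τ => isAllotted j (z i τ)) (allotmentsLaw p f T) := by
        have h0 : iIndepFun (fun (j : Fin K) (z : Fin K → Fin T → Fin K ⊕ Bool) => z j)
            (allotmentsLaw p f T) :=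
          iIndepFun_pi (μ := fun j => Measure.pi fun _ : Fin T =>
            allotmentLaw (fun i => f s(i, j)) (p j)) (X := fun _ y => y)
            fun _ => aemeasurable_id
        exact (h0.indepFun (Ne.symm hij)).comp
          (φ := fun (y : Fin T → Fin K ⊕ Bool) τ => isAllotted i (y τ))
          (ψ := fun (y : Fin T → Fin K ⊕ Bool) τ => isAllotted j (y τ))
          (measurable_of_countable _) (measurable_of_countable _)
      rw [indepFun_iff_map_prod_eq_prod_map_map (hm i j).aemeasurable (hm j i).aemeasurable,
        hlaw i j, hlaw j i, Sym2.eq_swap (a := j)] at hind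
      rw [← hind, map_measureReal_apply ((hm i j).prodMk (hm j i))
        (Set.to_countable _).measurableSet] at h
      exact h

/-- On average over the creation of link pairs, the best choice of swapping operations is at least
as good as the one that follows a random allotment. -/
lemma sum_mul_le_lintegral_maxWeight (hf : f ∈ sustainable p) (hp : ∀ k, p k ≤ 1) {δ : ℝ}
    {x : Pair K → ℝ}
    (h : ∀ e, ((trialsLaw T (f e)).prod (trialsLaw T (f e))).real
      {w | ((min (successCount w.1) (successCount w.2) : ℕ) : ℝ) < x e} ≤ δ) (w : Pair K → ℕ) :
    ∑ i, ∑ j, (w s(i, j) : ℝ≥0∞) * (ENNReal.ofReal (x s(i, j)) * ENNReal.ofReal (1 - δ)) ≤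
      ∫⁻ c, (maxWeight w c : ℝ≥0∞) ∂(Measure.pi fun j => trialsLaw T (p j)) := by
  have hpr := isProbabilityMeasure_allotmentsLaw (T := T) hf hp
  have hmean : ∀ e, ENNReal.ofReal (x e) * ENNReal.ofReal (1 - δ) ≤
      ∫⁻ z, (allottedSwaps z e : ℝ≥0∞) ∂(allotmentsLaw p f T) := by
    intro e
    refine le_trans ?_ (mul_meas_ge_le_lintegral (measurable_of_countable _)
      (ENNReal.ofReal (x e)))
    gcongr
    have hlt := allottedSwaps_lt_le hf hp e (h e)
    have hcompl := probReal_compl_eq_one_sub (μ := allotmentsLaw p f T)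
      (s := {z | (allottedSwaps z e : ℝ) < x e}) (Set.to_countable _).measurableSet
    refine (ENNReal.ofReal_le_ofReal (q := (allotmentsLaw p f T).real
      {z | (allottedSwaps z e : ℝ) < x e}ᶜ) (by linarith)).trans ?_
    rw [ofReal_measureReal]
    refine measure_mono fun z hz => ?_
    have hz' : x e ≤ (allottedSwaps z e : ℝ) := not_lt.mp hz
    simpa using ENNReal.ofReal_le_ofReal hz'
  rw [← map_isLink_allotmentsLaw hf hp, lintegral_map (measurable_of_countable _)
    (measurable_of_countable _)]
  calc _ ≤ ∑ i, ∑ j, (w s(i, j) : ℝ≥0∞) *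
        ∫⁻ z, (allottedSwaps z s(i, j) : ℝ≥0∞) ∂(allotmentsLaw p f T) := by
        gcongr with i _ j _
        exact hmean _
    _ = ∫⁻ z, ((∑ i, ∑ j, w s(i, j) * allottedSwaps z s(i, j) : ℕ) : ℝ≥0∞)
          ∂(allotmentsLaw p f T) := by
        push_cast
        rw [lintegral_finsetSum _ fun _ _ => measurable_of_countable _]
        refine Finset.sum_congr rfl fun i _ => ?_
        rw [lintegral_finsetSum _ fun _ _ => measurable_of_countable _]
        exact Finset.sum_congr rfl fun j _ =>
          (lintegral_const_mul _ (measurable_of_countable _)).symm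
    _ ≤ _ := lintegral_mono fun z => Nat.cast_le.mpr (le_maxWeight w (sum_allottedSwaps_le z))

end

/-! ### Expected drift and stability -/

lemma lintegral_sum_sum {ι Ω : Type*} [Fintype ι] [MeasurableSpace Ω] (μ : Measure Ω)
    {F : ι → ι → Ω → ℝ≥0∞} (hF : ∀ i j, Measurable (F i j)) :
    ∫⁻ ω, ∑ i, ∑ j, F i j ω ∂μ = ∑ i, ∑ j, ∫⁻ ω, F i j ω ∂μ := by
  rw [lintegral_finsetSum _ fun i _ => Finset.measurable_sum _ fun j _ => hF i j]
  exact Finset.sum_congr rfl fun i _ => lintegral_finsetSum _ fun j _ => hF i j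

namespace Switch

variable {K : ℕ} {Ω : Type*} [mΩ : MeasurableSpace Ω] {S : Switch K Ω} {μ : Measure Ω}
  [IsProbabilityMeasure μ] {p : Fin K → ℝ} {q : ℝ} {lam : Pair K → ℝ}

omit mΩ in
lemma past_mono (S : Switch K Ω) {s t : ℕ} (h : s ≤ t) : S.past s ≤ S.past t := by
  refine iSup₂_le fun x hx => S.sourceInfo_le_past ?_
  cases x with
  | seed => exact trivial
  | requests e => exact trivial
  | generated r k => exact lt_of_lt_of_le hx h
  | outcome r e n => exact lt_of_lt_of_le hx h

omit mΩ in
/-- The numbers of pending requests are a function of the history. -/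
lemma exists_pending_eq (S : Switch K Ω) (t : ℕ) (e : Pair K) :
    ∃ g : (Fin t → Observation K) → ℕ, ∀ ω, S.pending t ω e = g (S.history t ω) := by
  cases t with
  | zero => exact ⟨fun _ => 0, fun ω => rfl⟩
  | succ t =>
    exact ⟨fun h => ((h (Fin.last t)).2.1 e - ((h (Fin.last t)).1 e +
      (h (Fin.last t)).2.2.2.1 e)) + (h (Fin.last t)).2.2.1 e, fun ω => rfl⟩

omit [IsProbabilityMeasure μ] in
lemma IsModel.measurable_requests_ennreal (hM : S.IsModel μ p q lam) (t : ℕ) (e : Pair K) :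
    Measurable fun ω => (S.requests t ω e : ℝ≥0∞) :=
  (measurable_of_countable fun n : ℕ => (n : ℝ≥0∞)).comp (hM.measurable_requests t e)

omit [IsProbabilityMeasure μ] in
lemma IsModel.measurable_arrivals (hM : S.IsModel μ p q lam) (t T : ℕ) (e : Pair K) :
    Measurable fun ω => S.arrivals t T ω e :=
  Finset.measurable_sum _ fun τ _ => hM.measurable_requests (t + τ) e

/-- The bound on the conditional mean of the requests of one period, on a single history.  The
integrability that makes the hypothesis meaningful follows from the second moments. -/
lemma setLIntegral_arrivals_le (hM : S.IsModel μ p q lam) {δ : ℝ} {T : ℕ}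
    (hT : 0 < T) (hR : S.MeanRequestsNear μ lam δ T) (t : ℕ) (e : Pair K)
    (h : Fin t → Observation K) :
    ∫⁻ ω in S.historyEvent t h, (S.arrivals t T ω e : ℝ≥0∞) ∂μ ≤
      ENNReal.ofReal (T * (lam e + δ)) * μ (S.historyEvent t h) := by
  set B := S.historyEvent t h with hB
  have hT' : (0 : ℝ) < T := by exact_mod_cast hT
  by_cases h0 : μ B = 0
  · rw [Measure.restrict_eq_zero.mpr h0]; simp
  have hBtop : μ B ≠ ∞ := measure_ne_top μ B
  have hcond : ∀ g : Ω → ℝ≥0∞, ∫⁻ ω, g ω ∂(μ[|B]) = (μ B)⁻¹ * ∫⁻ ω in B, g ω ∂μ := fun g => by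
    rw [ProbabilityTheory.cond, lintegral_smul_measure, smul_eq_mul]
  have hterm : ∀ τ, ENNReal.ofReal (∫ ω, (S.requests τ ω e : ℝ) ∂(μ[|B])) =
      ∫⁻ ω, (S.requests τ ω e : ℝ≥0∞) ∂(μ[|B]) := by
    intro τ
    have hfin : ∫⁻ ω, (S.requests τ ω e : ℝ≥0∞) ∂(μ[|B]) < ∞ := by
      rw [hcond]
      exact ENNReal.mul_lt_top (ENNReal.inv_lt_top.mpr (pos_iff_ne_zero.mpr h0))
        ((setLIntegral_le_lintegral _ _).trans_lt (hM.lintegral_requests_lt_top τ e))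
    rw [ofReal_integral_eq_lintegral_ofReal]
    · simp
    · have hm : Measurable fun ω => (S.requests τ ω e : ℝ) :=
        (measurable_of_countable fun n : ℕ => (n : ℝ)).comp (hM.measurable_requests τ e)
      refine ⟨hm.aestronglyMeasurable, ?_⟩
      rw [hasFiniteIntegral_iff_ofReal (ae_of_all _ fun ω => Nat.cast_nonneg _)]
      simpa using hfin
    · exact ae_of_all _ fun ω => Nat.cast_nonneg _
  have hnear := hR t h h0 e
  rw [Finset.sum_Ico_eq_sum_range, Nat.add_sub_cancel_left] at hnear
  have hsum : ∑ τ ∈ Finset.range T, ∫ ω, (S.requests (t + τ) ω e : ℝ) ∂(μ[|B]) ≤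
      T * (lam e + δ) := by
    have h2 := (abs_le.mp hnear).1
    have h3 : (1 / (T : ℝ)) * ∑ τ ∈ Finset.range T, ∫ ω, (S.requests (t + τ) ω e : ℝ) ∂(μ[|B]) ≤
      lam e + δ := by linarith
    rwa [one_div, inv_mul_le_iff₀ hT'] at h3
  have hkey : (μ B)⁻¹ * ∫⁻ ω in B, (S.arrivals t T ω e : ℝ≥0∞) ∂μ ≤
      ENNReal.ofReal (T * (lam e + δ)) := by
    rw [← hcond]
    refine le_trans (le_of_eq ?_) (ENNReal.ofReal_le_ofReal hsum)
    rw [ENNReal.ofReal_sum_of_nonneg fun τ _ => integral_nonneg fun ω => Nat.cast_nonneg _]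
    simp only [hterm, arrivals, Nat.cast_sum]
    exact lintegral_finsetSum _ fun τ _ => hM.measurable_requests_ennreal (t + τ) e
  calc _ = ((μ B)⁻¹ * ∫⁻ ω in B, (S.arrivals t T ω e : ℝ≥0∞) ∂μ) * μ B := by
        rw [mul_comm (μ B)⁻¹, mul_assoc, ENNReal.inv_mul_cancel h0 hBtop, mul_one]
    _ ≤ _ := by gcongr

/-- The condition on the conditional means of the requests, integrated against a queue length. -/
lemma lintegral_pending_mul_arrivals_le (hM : S.IsModel μ p q lam) (hP : S.IsProtocol) {δ : ℝ}
    {T : ℕ} (hT : 0 < T) (hR : S.MeanRequestsNear μ lam δ T) (t : ℕ) (e : Pair K) :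
    ∫⁻ ω, ((S.pending t ω e * S.arrivals t T ω e : ℕ) : ℝ≥0∞) ∂μ ≤
      ENNReal.ofReal (T * (lam e + δ)) * ∫⁻ ω, (S.pending t ω e : ℝ≥0∞) ∂μ := by
  obtain ⟨g, hg⟩ := S.exists_pending_eq t e
  have hmeas : ∀ h, MeasurableSet (S.historyEvent t h) := fun h =>
    hM.measurable_history hP t (measurableSet_singleton h)
  have hdisj : Pairwise (Function.onFun Disjoint (S.historyEvent t)) := by
    intro h h' hne
    refine Set.disjoint_left.mpr fun ω hω hω' => hne ?_
    exact (show S.history t ω = h from hω).symm.trans hω'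
  have hun : ⋃ h, S.historyEvent t h = Set.univ :=
    Set.eq_univ_of_forall fun ω => Set.mem_iUnion.mpr ⟨S.history t ω, rfl⟩
  have hsplit : ∀ F : Ω → ℝ≥0∞, ∫⁻ ω, F ω ∂μ = ∑' h, ∫⁻ ω in S.historyEvent t h, F ω ∂μ :=
    fun F => by rw [← lintegral_iUnion hmeas hdisj, hun, setLIntegral_univ]
  rw [hsplit, hsplit, ← ENNReal.tsum_mul_left]
  refine ENNReal.tsum_le_tsum fun h => ?_
  have hconst : ∀ ω ∈ S.historyEvent t h, S.pending t ω e = g h := fun ω hω => by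
    rw [hg, show S.history t ω = h from hω]
  rw [setLIntegral_congr_fun (g := fun ω => (g h : ℝ≥0∞) * (S.arrivals t T ω e : ℝ≥0∞)) (hmeas h)
      fun ω hω => by simp [hconst ω hω],
    setLIntegral_congr_fun (f := fun ω => (S.pending t ω e : ℝ≥0∞)) (g := fun _ => (g h : ℝ≥0∞))
      (hmeas h) fun ω hω => by simp [hconst ω hω],
    lintegral_const_mul' _ _ (ENNReal.natCast_ne_top _), setLIntegral_const]
  calc _ ≤ (g h : ℝ≥0∞) * (ENNReal.ofReal (T * (lam e + δ)) * μ (S.historyEvent t h)) := by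
        gcongr
        exact setLIntegral_arrivals_le hM hT hR t e h
    _ = _ := by ring

/-- The creation attempts are independent trials. -/
lemma IsModel.map_linkBlock (hp : ∀ k, 0 ≤ p k ∧ p k ≤ 1) (hM : S.IsModel μ p q lam) (t T : ℕ) :
    μ.map (S.linkBlock t T) = Measure.pi fun j => trialsLaw T (p j) := by
  have hb := fun j => isProbabilityMeasure_bernoulliLaw (hp j).1 (hp j).2
  have ht := fun j => isProbabilityMeasure_trialsLaw T (hp j).1 (hp j).2
  have hm : Measurable (S.linkBlock t T) := measurable_pi_iff.mpr fun j =>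
    measurable_pi_iff.mpr fun τ => hM.measurable_generated (t + τ) j
  have hlaw : ∀ s j, μ.map (fun ω => S.generated s ω j) = bernoulliLaw (p j) := by
    intro s j
    have := Measure.isProbabilityMeasure_map (μ := μ) (hM.measurable_generated s j).aemeasurable
    refine eq_bernoulliLaw ?_
    rw [map_measureReal_apply (hM.measurable_generated s j) (measurableSet_singleton _)]
    exact hM.generated_prob s j
  have hinj : Function.Injective fun x : Fin K × Fin T => (Source.generated (t + x.2) x.1 :
      Source K) := by
    rintro ⟨j, τ⟩ ⟨j', τ'⟩ h
    simp only [Source.generated.injEq, add_right_inj] at h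
    exact Prod.ext h.2 (Fin.ext h.1)
  have hind : iIndep (fun x : Fin K × Fin T => S.sourceInfo (.generated (t + x.2) x.1)) μ :=
    hM.independent.precomp hinj
  refine Measure.ext_of_singleton fun c => ?_
  rw [Measure.map_apply hm (measurableSet_singleton c), Measure.pi_singleton]
  have hset : S.linkBlock t T ⁻¹' {c} = ⋂ x ∈ (Finset.univ : Finset (Fin K × Fin T)),
      (fun ω => S.generated (t + x.2) ω x.1) ⁻¹' {c x.1 x.2} := by
    ext ω
    simp [funext_iff, linkBlock]
  rw [hset, hind.meas_biInter fun x _ => ⟨{c x.1 x.2}, measurableSet_singleton _, rfl⟩,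
    ← Finset.univ_product_univ, Finset.prod_product]
  refine Finset.prod_congr rfl fun j _ => ?_
  rw [trialsLaw, Measure.pi_singleton]
  refine Finset.prod_congr rfl fun τ _ => ?_
  rw [← hlaw (t + τ) j, Measure.map_apply (hM.measurable_generated _ j)
    (measurableSet_singleton _)]

omit [IsProbabilityMeasure μ] in
lemma IsModel.indepFun_pending_linkBlock (hM : S.IsModel μ p q lam) (hP : S.IsProtocol)
    (t T : ℕ) : IndepFun (S.pending t) (S.linkBlock t T) μ := by
  set A : Set (Source K) := {x | ∃ τ j, x = .generated (t + τ) j} with hA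
  have hdisj : Disjoint (pastSources K t) A := by
    refine Set.disjoint_left.mpr ?_
    rintro x hx ⟨τ, j, rfl⟩
    have : t + τ < t := hx
    omega
  have h := hM.indep_past hdisj
  have hle : MeasurableSpace.comap (S.linkBlock t T) inferInstance ≤
      ⨆ x ∈ A, S.sourceInfo x := by
    rw [← measurable_iff_comap_le]
    refine (@measurable_pi_iff _ _ _ (_) _ _).mpr fun j =>
      (@measurable_pi_iff _ _ _ (_) _ _).mpr fun τ => ?_
    exact Measurable.mono (comap_measurable _)
      (le_iSup₂_of_le (f := fun x (_ : x ∈ A) => S.sourceInfo x)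
        (Source.generated (t + τ) j) ⟨τ, j, rfl⟩ le_rfl) le_rfl
  exact indep_of_indep_of_le_left (indep_of_indep_of_le_right h hle)
    (S.past_measurable hP t).2.2.1.comap_le

/-- The expected weight of the successful swapping operations in a slot with decisions. -/
lemma sum_mul_le_lintegral_cappedSwaps (hp : ∀ k, 0 ≤ p k ∧ p k ≤ 1)
    (hM : S.IsModel μ p q lam) (hP : S.IsProtocol) {T : ℕ} (hT : 0 < T) (hW : S.IsMaxWeight T)
    {f : Pair K → ℝ} (hf : f ∈ sustainable p) {δ : ℝ} {x : Pair K → ℝ}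
    (h : ∀ e, ((trialsLaw T (f e)).prod (trialsLaw T (f e))).real
      {w | ((min (successCount w.1) (successCount w.2) : ℕ) : ℝ) < x e} ≤ δ)
    {s : ℕ} (hs : T ∣ s + 1) :
    ENNReal.ofReal q * ∑ i, ∑ j, ENNReal.ofReal (x s(i, j)) * ENNReal.ofReal (1 - δ) *
        ∫⁻ ω, (S.pending s ω s(i, j) : ℝ≥0∞) ∂μ ≤
      ∑ i, ∑ j, ∫⁻ ω,
        ((S.pending s ω s(i, j) * S.cappedSwaps (s + T) T ω s(i, j) : ℕ) : ℝ≥0∞) ∂μ := by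
  have hu : Measurable (S.pending s) := measurable_pi_iff.mpr (hM.measurable_pending hP s)
  have hc : Measurable (S.linkBlock s T) := measurable_pi_iff.mpr fun j =>
    measurable_pi_iff.mpr fun τ => hM.measurable_generated (s + τ) j
  have hue : ∀ e, Measurable fun ω => (S.pending s ω e : ℝ≥0∞) := fun e =>
    (measurable_of_countable fun n : ℕ => (n : ℝ≥0∞)).comp (hM.measurable_pending hP s e)
  have hF : ∀ e, Measurable fun ω =>
      ((S.pending s ω e * min (S.decision (s + T) ω e) T : ℕ) : ℝ≥0∞) := fun e =>
    (measurable_of_countable fun n : ℕ × ℕ => ((n.1 * min n.2 T : ℕ) : ℝ≥0∞)).comp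
      ((hM.measurable_pending hP s e).prodMk (hM.measurable_decision hP (s + T) e))
  have hwald : ∀ e, ∫⁻ ω, ((S.pending s ω e * S.cappedSwaps (s + T) T ω e : ℕ) : ℝ≥0∞) ∂μ =
      ENNReal.ofReal q *
        ∫⁻ ω, ((S.pending s ω e * min (S.decision (s + T) ω e) T : ℕ) : ℝ≥0∞) ∂μ := fun e =>
    hM.lintegral_mul_successes (s + T) e
      (((measurable_pi_apply e).comp (S.past_measurable hP s).2.2.1).mono
        (S.past_mono (Nat.le_add_right s T)) le_rfl)
      ((measurable_of_countable fun n : ℕ => min n T).comp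
        ((measurable_pi_apply e).comp (S.past_measurable hP (s + T)).2.1))
  have hmax : ∫⁻ ω, (maxWeight (S.pending s ω) (S.linkBlock s T ω) : ℝ≥0∞) ∂μ =
      ∫⁻ ω, ∫⁻ c, (maxWeight (S.pending s ω) c : ℝ≥0∞)
        ∂(Measure.pi fun j => trialsLaw T (p j)) ∂μ := by
    have hpr := Measure.isProbabilityMeasure_map (μ := μ) hc.aemeasurable
    have hjoint := (indepFun_iff_map_prod_eq_prod_map_map hu.aemeasurable hc.aemeasurable).mp
      (hM.indepFun_pending_linkBlock hP s T)
    have hmm : Measurable fun y : (Pair K → ℕ) × (Fin K → Fin T → Bool) =>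
      (maxWeight y.1 y.2 : ℝ≥0∞) := measurable_of_countable _
    have h1 := lintegral_map (μ := μ) hmm (hu.prodMk hc)
    rw [hjoint, lintegral_prod _ hmm.aemeasurable,
      lintegral_map (measurable_of_countable _) hu, hM.map_linkBlock hp] at h1
    exact h1.symm
  simp only [hwald, ← Finset.mul_sum]
  gcongr ENNReal.ofReal q * ?_
  calc ∑ i, ∑ j, ENNReal.ofReal (x s(i, j)) * ENNReal.ofReal (1 - δ) *
        ∫⁻ ω, (S.pending s ω s(i, j) : ℝ≥0∞) ∂μ
      = ∫⁻ ω, ∑ i, ∑ j, (S.pending s ω s(i, j) : ℝ≥0∞) *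
          (ENNReal.ofReal (x s(i, j)) * ENNReal.ofReal (1 - δ)) ∂μ := by
        rw [lintegral_sum_sum μ fun i j => (hue s(i, j)).mul_const _]
        refine Finset.sum_congr rfl fun i _ => Finset.sum_congr rfl fun j _ => ?_
        rw [lintegral_mul_const _ (hue s(i, j)), mul_comm]
    _ ≤ ∫⁻ ω, (maxWeight (S.pending s ω) (S.linkBlock s T ω) : ℝ≥0∞) ∂μ := by
        rw [hmax]
        exact lintegral_mono fun ω =>
          sum_mul_le_lintegral_maxWeight hf (fun k => (hp k).2) h (S.pending s ω)
    _ ≤ ∫⁻ ω, ((∑ i, ∑ j,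
          S.pending s ω s(i, j) * min (S.decision (s + T) ω s(i, j)) T : ℕ) : ℝ≥0∞) ∂μ :=
        lintegral_mono fun ω => Nat.cast_le.mpr (hW.maxWeight_le hP hT hs ω)
    _ = _ := by
        simp only [Nat.cast_sum]
        exact lintegral_sum_sum μ fun i j => hF s(i, j)

lemma IsModel.lintegral_arrivals (hM : S.IsModel μ p q lam) (t T : ℕ) (e : Pair K) :
    ∫⁻ ω, (S.arrivals t T ω e : ℝ≥0∞) ∂μ = T * ENNReal.ofReal (lam e) := by
  simp only [arrivals, Nat.cast_sum]
  rw [lintegral_finsetSum _ fun τ _ => hM.measurable_requests_ennreal (t + τ) e]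
  simp [hM.lintegral_requests]

omit [IsProbabilityMeasure μ] in
lemma IsModel.lintegral_arrivals_sq_le (hM : S.IsModel μ p q lam) {M : ℝ}
    (hsq : ∀ t e, ∫⁻ ω, (S.requests t ω e : ℝ≥0∞) ^ 2 ∂μ ≤ ENNReal.ofReal M) (t T : ℕ)
    (e : Pair K) :
    ∫⁻ ω, ((S.arrivals t T ω e ^ 2 : ℕ) : ℝ≥0∞) ∂μ ≤ T ^ 2 * ENNReal.ofReal M := by
  calc ∫⁻ ω, ((S.arrivals t T ω e ^ 2 : ℕ) : ℝ≥0∞) ∂μ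
      ≤ ∫⁻ ω, T * ∑ τ ∈ Finset.range T, (S.requests (t + τ) ω e : ℝ≥0∞) ^ 2 ∂μ := by
        refine lintegral_mono fun ω => ?_
        have h := sq_sum_le_card_mul_sum_sq (s := Finset.range T)
          (f := fun τ => S.requests (t + τ) ω e)
        rw [Finset.card_range] at h
        have h2 : ((S.arrivals t T ω e ^ 2 : ℕ) : ℝ≥0∞) ≤
          ((T * ∑ τ ∈ Finset.range T, S.requests (t + τ) ω e ^ 2 : ℕ) : ℝ≥0∞) :=
          Nat.cast_le.mpr h
        refine h2.trans_eq ?_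
        push_cast
        rfl
    _ ≤ T * ∑ τ ∈ Finset.range T, ENNReal.ofReal M := by
        rw [lintegral_const_mul' _ _ (ENNReal.natCast_ne_top T),
          lintegral_finsetSum _ fun τ _ => (hM.measurable_requests_ennreal (t + τ) e).pow_const 2]
        gcongr
        exact hsq _ _
    _ = _ := by simp [pow_two, mul_assoc]

omit mΩ in
lemma pending_le_arrivals (S : Switch K Ω) (t : ℕ) (ω : Ω) (e : Pair K) :
    S.pending t ω e ≤ S.arrivals 0 t ω e := by
  have h := S.pending_add_le_add_arrivals 0 t ω e
  rw [zero_add] at h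
  exact h.trans_eq (Nat.zero_add _)

lemma IsModel.lintegral_pending_ne_top (hM : S.IsModel μ p q lam) (t : ℕ) (e : Pair K) :
    ∫⁻ ω, (S.pending t ω e : ℝ≥0∞) ∂μ ≠ ∞ := by
  refine ne_top_of_le_ne_top ?_
    (lintegral_mono fun ω => Nat.cast_le.mpr (S.pending_le_arrivals t ω e))
  rw [hM.lintegral_arrivals]
  exact ENNReal.mul_ne_top (ENNReal.natCast_ne_top t) ENNReal.ofReal_ne_top

lemma IsModel.lintegral_pending_sq_ne_top (hM : S.IsModel μ p q lam) (t : ℕ) (e : Pair K) :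
    ∫⁻ ω, ((S.pending t ω e ^ 2 : ℕ) : ℝ≥0∞) ∂μ ≠ ∞ := by
  obtain ⟨M, -, hsq⟩ := hM.exists_sq_le
  refine ne_top_of_le_ne_top ?_ ((lintegral_mono fun ω => Nat.cast_le.mpr
    (Nat.pow_le_pow_left (S.pending_le_arrivals t ω e) 2)).trans
      (hM.lintegral_arrivals_sq_le hsq 0 t e))
  exact ENNReal.mul_ne_top (ENNReal.pow_ne_top (ENNReal.natCast_ne_top t)) ENNReal.ofReal_ne_top

lemma IsModel.lintegral_lyapunov_ne_top (hM : S.IsModel μ p q lam) (hP : S.IsProtocol) (T t : ℕ) :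
    ∫⁻ ω, (S.lyapunov T t ω : ℝ≥0∞) ∂μ ≠ ∞ := by
  have hm : ∀ t e, Measurable fun ω => ((S.pending t ω e ^ 2 : ℕ) : ℝ≥0∞) := fun t e =>
    (measurable_of_countable fun n : ℕ => ((n ^ 2 : ℕ) : ℝ≥0∞)).comp (hM.measurable_pending hP t e)
  have hm' : ∀ t e, Measurable fun ω => (S.pending t ω e : ℝ≥0∞) := fun t e =>
    (measurable_of_countable fun n : ℕ => (n : ℝ≥0∞)).comp (hM.measurable_pending hP t e)
  have hle : ∀ ω, (S.lyapunov T t ω : ℝ≥0∞) ≤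
      ∑ i, ∑ j, (((S.pending (t + T) ω s(i, j) ^ 2 : ℕ) : ℝ≥0∞) +
        ((2 * T : ℕ) : ℝ≥0∞) * (S.pending t ω s(i, j) : ℝ≥0∞)) := by
    intro ω
    simp only [← Nat.cast_mul, ← Nat.cast_add, ← Nat.cast_sum, lyapunov]
    refine Nat.cast_le.mpr (Finset.sum_le_sum fun i _ => Finset.sum_le_sum fun j _ => ?_)
    gcongr
    exact Nat.sub_le _ _
  refine ne_top_of_le_ne_top ?_ (lintegral_mono hle)
  rw [lintegral_sum_sum μ fun i j => by
    exact (hm (t + T) s(i, j)).add ((hm' t s(i, j)).const_mul ((2 * T : ℕ) : ℝ≥0∞))]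
  refine ENNReal.sum_ne_top.mpr fun i _ => ENNReal.sum_ne_top.mpr fun j _ => ?_
  rw [lintegral_add_left (hm _ _), lintegral_const_mul _ (hm' _ _)]
  exact ENNReal.add_ne_top.mpr ⟨hM.lintegral_pending_sq_ne_top _ _,
    ENNReal.mul_ne_top (ENNReal.natCast_ne_top _) (hM.lintegral_pending_ne_top _ _)⟩

/-- The expected number of pending requests. -/
noncomputable def meanPending (S : Switch K Ω) (μ : Measure Ω) (t : ℕ) (e : Pair K) : ℝ :=
  (∫⁻ ω, (S.pending t ω e : ℝ≥0∞) ∂μ).toReal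

/-- The expected value of the Lyapunov function. -/
noncomputable def meanLyapunov (S : Switch K Ω) (μ : Measure Ω) (T t : ℕ) : ℝ :=
  (∫⁻ ω, (S.lyapunov T t ω : ℝ≥0∞) ∂μ).toReal

lemma IsModel.ofReal_meanPending (hM : S.IsModel μ p q lam) (t : ℕ) (e : Pair K) :
    ENNReal.ofReal (S.meanPending μ t e) = ∫⁻ ω, (S.pending t ω e : ℝ≥0∞) ∂μ :=
  ENNReal.ofReal_toReal (hM.lintegral_pending_ne_top t e)

omit [IsProbabilityMeasure μ] in
lemma meanPending_nonneg (t : ℕ) (e : Pair K) : 0 ≤ S.meanPending μ t e := ENNReal.toReal_nonneg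

lemma meanPending_add_le (hlam : ∀ e, 0 ≤ lam e) (hM : S.IsModel μ p q lam) (t T : ℕ)
    (e : Pair K) : S.meanPending μ (t + T) e ≤ S.meanPending μ t e + T * lam e := by
  have h0 : 0 ≤ T * lam e := mul_nonneg (Nat.cast_nonneg T) (hlam e)
  rw [← ENNReal.ofReal_le_ofReal_iff (add_nonneg (meanPending_nonneg t e) h0),
    ENNReal.ofReal_add (meanPending_nonneg t e) h0, hM.ofReal_meanPending, hM.ofReal_meanPending,
    ENNReal.ofReal_mul (Nat.cast_nonneg T), ENNReal.ofReal_natCast, ← hM.lintegral_arrivals t T e,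
    ← lintegral_add_right]
  · refine lintegral_mono fun ω => ?_
    rw [← Nat.cast_add]
    exact Nat.cast_le.mpr (S.pending_add_le_add_arrivals t T ω e)
  · exact (measurable_of_countable fun n : ℕ => (n : ℝ≥0∞)).comp (hM.measurable_arrivals t T e)

/-- Negative expected drift over one period: the service of the slot `s + T`, weighted with the
queues of slot `s`, exceeds the requests that arrive from then on during one period by at least
`ε / 4` per slot and pending request. -/
lemma meanLyapunov_add_le (hp : ∀ k, 0 ≤ p k ∧ p k ≤ 1) (hq : 0 ≤ q ∧ q ≤ 1)
    (hlam : ∀ e, 0 ≤ lam e) {ε : ℝ} (hε : 0 < ε) {f : Pair K → ℝ} {δ : ℝ} {T : ℕ}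
    (hper : IsPeriod p q lam ε f δ T) (hM : S.IsModel μ p q lam)
    (hR : S.MeanRequestsNear μ lam δ T) (hP : S.IsProtocol) (hW : S.IsMaxWeight T) :
    ∃ B : ℝ, 0 ≤ B ∧ ∀ s, T ∣ s + 1 →
      S.meanLyapunov μ T (s + T) + T * ε / 2 * ∑ i, ∑ j, S.meanPending μ s s(i, j) ≤
        S.meanLyapunov μ T s + B := by
  obtain ⟨M, hM0, hsq⟩ := hM.exists_sq_le
  have hT := hper.T₀_pos
  have hT' : (0 : ℝ) < T := by exact_mod_cast hT
  have hδ := hper.δ_pos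
  have hδ' : ∀ e, 0 ≤ lam e + δ := fun e => add_nonneg (hlam e) hδ.le
  -- `q ≤ 1` forces `ε ≤ f e`, so that the rates of the comparison are positive.
  have hfε : ∀ e, 0 ≤ f e - ε / 2 := fun e => by
    have h1 := hper.lam_le e
    have h2 := hlam e
    have h3 : q * f e ≤ f e := mul_le_of_le_one_left (hper.f_nonneg e) hq.2
    linarith
  refine ⟨∑ i : Fin K, ∑ j : Fin K, (2 * (T * (lam s(i, j) + δ)) * (T * lam s(i, j)) +
    T ^ 2 * M + 4 * T ^ 2), Finset.sum_nonneg fun i _ => Finset.sum_nonneg fun j _ => ?_,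
    fun s hs => ?_⟩
  · have := hδ' s(i, j)
    have := hlam s(i, j)
    positivity
  by_cases hK : IsEmpty (Fin K)
  · simp [meanLyapunov, lyapunov]
  -- With `f e ≥ ε / 2`, the condition on `δ` forces `δ < 1`.
  have hδ1 : 0 ≤ 1 - δ := by
    obtain ⟨k⟩ := not_isEmpty_iff.mp hK
    by_contra hneg
    have h1 := hper.δ_small s(k, k)
    have h2 := hlam s(k, k)
    have h3 : q * (f s(k, k) - ε / 2) * (1 - δ) ≤ 0 :=
      mul_nonpos_of_nonneg_of_nonpos (mul_nonneg hq.1 (hfε _)) (by linarith)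
    linarith
  have hmu : ∀ t e, Measurable fun ω => S.pending t ω e := hM.measurable_pending hP
  have hma := hM.measurable_arrivals
  have hmc : ∀ e, Measurable fun ω => S.cappedSwaps (s + T) T ω e := fun e =>
    hM.measurable_successes (s + T) e ((measurable_of_countable fun n : ℕ => min n T).comp
      (hM.measurable_decision hP (s + T) e))
  have hcast : Measurable fun n : ℕ => (n : ℝ≥0∞) := measurable_of_countable _
  have hm1 : ∀ e, Measurable fun ω =>
      ((S.pending s ω e * S.cappedSwaps (s + T) T ω e : ℕ) : ℝ≥0∞) := fun e =>
    hcast.comp ((hmu s e).mul (hmc e))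
  have hm2 : ∀ e, Measurable fun ω =>
      ((S.pending (s + T) ω e * S.arrivals (s + T) T ω e : ℕ) : ℝ≥0∞) := fun e =>
    hcast.comp ((hmu _ e).mul (hma _ T e))
  have hm3 : ∀ e, Measurable fun ω => ((S.arrivals (s + T) T ω e ^ 2 : ℕ) : ℝ≥0∞) := fun e =>
    hcast.comp ((hma _ T e).pow_const 2)
  have hm4 : ∀ e, Measurable fun ω =>
      2 * ((S.pending (s + T) ω e * S.arrivals (s + T) T ω e : ℕ) : ℝ≥0∞) +
        ((S.arrivals (s + T) T ω e ^ 2 : ℕ) : ℝ≥0∞) + ((4 * T ^ 2 : ℕ) : ℝ≥0∞) := fun e =>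
    (((hm2 e).const_mul 2).add (hm3 e)).add measurable_const
  have hpath : ∀ ω, (S.lyapunov T (s + T) ω : ℝ≥0∞) + 2 * ∑ i, ∑ j,
      ((S.pending s ω s(i, j) * S.cappedSwaps (s + T) T ω s(i, j) : ℕ) : ℝ≥0∞) ≤
      (S.lyapunov T s ω : ℝ≥0∞) + ∑ i, ∑ j,
        (2 * ((S.pending (s + T) ω s(i, j) * S.arrivals (s + T) T ω s(i, j) : ℕ) : ℝ≥0∞) +
        ((S.arrivals (s + T) T ω s(i, j) ^ 2 : ℕ) : ℝ≥0∞) + ((4 * T ^ 2 : ℕ) : ℝ≥0∞)) := by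
    intro ω
    have h : ((_ : ℕ) : ℝ≥0∞) ≤ ((_ : ℕ) : ℝ≥0∞) := Nat.cast_le.mpr (S.lyapunov_add_le s hT ω)
    simpa only [Nat.cast_add, Nat.cast_mul, Nat.cast_sum, Nat.cast_ofNat] using h
  have hint := lintegral_mono (μ := μ) hpath
  rw [lintegral_add_right _ ((Finset.measurable_sum _ fun i _ =>
      Finset.measurable_sum _ fun j _ => hm1 s(i, j)).const_mul 2),
    lintegral_const_mul _ (Finset.measurable_sum _ fun i _ =>
      Finset.measurable_sum _ fun j _ => hm1 s(i, j)),
    lintegral_add_right _ (Finset.measurable_sum _ fun i _ =>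
      Finset.measurable_sum _ fun j _ => hm4 s(i, j)),
    lintegral_sum_sum μ fun i j => hm1 s(i, j),
    lintegral_sum_sum μ fun i j => hm4 s(i, j)] at hint
  have hU : ∑ i, ∑ j, ∫⁻ ω,
      (2 * ((S.pending (s + T) ω s(i, j) * S.arrivals (s + T) T ω s(i, j) : ℕ) : ℝ≥0∞) +
        ((S.arrivals (s + T) T ω s(i, j) ^ 2 : ℕ) : ℝ≥0∞) + ((4 * T ^ 2 : ℕ) : ℝ≥0∞)) ∂μ ≤
      ENNReal.ofReal (∑ i, ∑ j, (2 * (T * (lam s(i, j) + δ) * S.meanPending μ (s + T) s(i, j)) +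
        T ^ 2 * M + 4 * T ^ 2)) := by
    have hnn : ∀ i j, 0 ≤ 2 * (T * (lam s(i, j) + δ) * S.meanPending μ (s + T) s(i, j)) +
        T ^ 2 * M + 4 * T ^ 2 := fun i j => by
      have := hδ' s(i, j)
      have := meanPending_nonneg (S := S) (μ := μ) (s + T) s(i, j)
      positivity
    rw [ENNReal.ofReal_sum_of_nonneg fun i _ => Finset.sum_nonneg fun j _ => hnn i j]
    refine Finset.sum_le_sum fun i _ => ?_
    rw [ENNReal.ofReal_sum_of_nonneg fun j _ => hnn i j]
    refine Finset.sum_le_sum fun j _ => ?_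
    have h1 := lintegral_pending_mul_arrivals_le hM hP hT hR (s + T) s(i, j)
    have h2 := hM.lintegral_arrivals_sq_le hsq (s + T) T s(i, j)
    have hx := meanPending_nonneg (S := S) (μ := μ) (s + T) s(i, j)
    have hd := hδ' s(i, j)
    rw [lintegral_add_right _ measurable_const, lintegral_add_right _ (hm3 s(i, j)),
      lintegral_const_mul _ (hm2 s(i, j)), lintegral_const, measure_univ, mul_one,
      ENNReal.ofReal_add (by positivity) (by positivity),
      ENNReal.ofReal_add (by positivity) (by positivity)]
    refine add_le_add (add_le_add ?_ ?_) ?_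
    · rw [ENNReal.ofReal_mul (by norm_num), ENNReal.ofReal_mul (mul_nonneg hT'.le hd),
        hM.ofReal_meanPending, ENNReal.ofReal_ofNat]
      gcongr
    · rwa [ENNReal.ofReal_mul (by positivity), ENNReal.ofReal_pow hT'.le, ENNReal.ofReal_natCast]
    · rw [← ENNReal.ofReal_natCast]
      push_cast
      exact le_rfl
  have hserve := sum_mul_le_lintegral_cappedSwaps hp hM hP hT hW
    (show f ∈ sustainable p from ⟨hper.f_nonneg, hper.sum_f_le⟩)
    (x := fun e => T * (f e - ε / 2)) hper.trials hs
  have hnn : ∀ i j, 0 ≤ T * (f s(i, j) - ε / 2) * (1 - δ) * S.meanPending μ s s(i, j) :=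
    fun i j => mul_nonneg (mul_nonneg (mul_nonneg hT'.le (hfε _)) hδ1) (meanPending_nonneg _ _)
  have hS : ENNReal.ofReal (q * ∑ i, ∑ j,
      T * (f s(i, j) - ε / 2) * (1 - δ) * S.meanPending μ s s(i, j)) ≤
      ∑ i, ∑ j, ∫⁻ ω, ((S.pending s ω s(i, j) *
        S.cappedSwaps (s + T) T ω s(i, j) : ℕ) : ℝ≥0∞) ∂μ := by
    refine le_trans (le_of_eq ?_) hserve
    rw [ENNReal.ofReal_mul hq.1,
      ENNReal.ofReal_sum_of_nonneg fun i _ => Finset.sum_nonneg fun j _ => hnn i j]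
    congr 1
    refine Finset.sum_congr rfl fun i _ => ?_
    rw [ENNReal.ofReal_sum_of_nonneg fun j _ => hnn i j]
    refine Finset.sum_congr rfl fun j _ => ?_
    rw [ENNReal.ofReal_mul (mul_nonneg (mul_nonneg hT'.le (hfε _)) hδ1),
      ENNReal.ofReal_mul (mul_nonneg hT'.le (hfε _)), hM.ofReal_meanPending]
  have hS0 : 0 ≤ q * ∑ i, ∑ j, T * (f s(i, j) - ε / 2) * (1 - δ) * S.meanPending μ s s(i, j) :=
    mul_nonneg hq.1 (Finset.sum_nonneg fun i _ => Finset.sum_nonneg fun j _ => hnn i j)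
  have hU0 : 0 ≤ ∑ i, ∑ j, (2 * (T * (lam s(i, j) + δ) * S.meanPending μ (s + T) s(i, j)) +
        T ^ 2 * M + 4 * T ^ 2) :=
    Finset.sum_nonneg fun i _ => Finset.sum_nonneg fun j _ => by
      have := hδ' s(i, j)
      have := meanPending_nonneg (S := S) (μ := μ) (s + T) s(i, j)
      positivity
  have hreal : S.meanLyapunov μ T (s + T) + 2 * (q * ∑ i, ∑ j,
      T * (f s(i, j) - ε / 2) * (1 - δ) * S.meanPending μ s s(i, j)) ≤
      S.meanLyapunov μ T s + ∑ i, ∑ j,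
        (2 * (T * (lam s(i, j) + δ) * S.meanPending μ (s + T) s(i, j)) +
          T ^ 2 * M + 4 * T ^ 2) := by
    have hl0 : ∀ t, 0 ≤ S.meanLyapunov μ T t := fun t => ENNReal.toReal_nonneg
    rw [← ENNReal.ofReal_le_ofReal_iff (add_nonneg (hl0 s) hU0),
      ENNReal.ofReal_add (hl0 _) (by positivity), ENNReal.ofReal_add (hl0 _) hU0,
      ENNReal.ofReal_mul (by norm_num), meanLyapunov, meanLyapunov,
      ENNReal.ofReal_toReal (hM.lintegral_lyapunov_ne_top hP _ _),
      ENNReal.ofReal_toReal (hM.lintegral_lyapunov_ne_top hP _ _), ENNReal.ofReal_ofNat]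
    exact (add_le_add_right (mul_le_mul_right hS 2) _).trans (hint.trans (add_le_add_right hU _))
  have hcmp : ∑ i, ∑ j, (2 * (T * (lam s(i, j) + δ) * S.meanPending μ (s + T) s(i, j)) +
          T ^ 2 * M + 4 * T ^ 2) + T * ε / 2 * ∑ i, ∑ j, S.meanPending μ s s(i, j) ≤
      2 * (q * ∑ i, ∑ j, T * (f s(i, j) - ε / 2) * (1 - δ) * S.meanPending μ s s(i, j)) +
      ∑ i : Fin K, ∑ j : Fin K, (2 * (T * (lam s(i, j) + δ)) * (T * lam s(i, j)) +
        T ^ 2 * M + 4 * T ^ 2) := by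
    simp only [Finset.mul_sum, ← Finset.sum_add_distrib]
    refine Finset.sum_le_sum fun i _ => Finset.sum_le_sum fun j _ => ?_
    have h1 := meanPending_add_le hlam hM s T s(i, j)
    have h2 := hper.δ_small s(i, j)
    have hx := meanPending_nonneg (S := S) (μ := μ) s s(i, j)
    have h3 : T * (lam s(i, j) + δ) * S.meanPending μ (s + T) s(i, j) ≤
        T * (lam s(i, j) + δ) * (S.meanPending μ s s(i, j) + T * lam s(i, j)) :=
      mul_le_mul_of_nonneg_left h1 (mul_nonneg hT'.le (hδ' _))
    have h4 := mul_le_mul_of_nonneg_left h2 (mul_nonneg hT'.le hx)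
    linarith
  linarith

end Switch

/-- Summing a drift inequality that holds at the ends of periods of length `T`, for a sequence `x`
with bounded increments. -/
lemma exists_sum_range_le_of_drift {x φ : ℕ → ℝ} {T : ℕ} {c B L : ℝ} (hT : 0 < T)
    (hx : ∀ t, 0 ≤ x t) (hφ : ∀ m, 0 ≤ φ m) (hc : 0 < c) (hB : 0 ≤ B) (hL : 0 ≤ L)
    (hinc : ∀ t, x (t + 1) ≤ x t + L)
    (hdrift : ∀ m, φ (m + 1) + c * x ((m + 1) * T - 1) ≤ φ m + B) :
    ∃ C : ℝ, 0 ≤ C ∧ ∀ t : ℕ, ∑ τ ∈ Finset.range t, x τ ≤ C * (t + 1) := by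
  have hadd : ∀ t k : ℕ, x (t + k) ≤ x t + k * L := by
    intro t k
    induction k with
    | zero => simp
    | succ k ih =>
      have := hinc (t + k)
      push_cast
      rw [← add_assoc t k 1]
      linarith
  have htel : ∀ n : ℕ, φ n + c * ∑ m ∈ Finset.range n, x ((m + 1) * T - 1) ≤ φ 0 + n * B := by
    intro n
    induction n with
    | zero => simp
    | succ n ih =>
      have := hdrift n
      rw [Finset.sum_range_succ]
      push_cast
      linarith
  have hblock : ∀ n : ℕ, ∑ τ ∈ Finset.range ((n + 1) * T - 1), x τ ≤
      ∑ τ ∈ Finset.range (T - 1), x τ +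
        (T * ∑ m ∈ Finset.range n, x ((m + 1) * T - 1) + n * (T * (T * L))) := by
    intro n
    induction n with
    | zero => simp
    | succ n ih =>
      have hsplit : (n + 1 + 1) * T - 1 = ((n + 1) * T - 1) + T := by
        have : T ≤ (n + 1) * T := Nat.le_mul_of_pos_left _ (Nat.succ_pos n)
        have h2 : (n + 1 + 1) * T = (n + 1) * T + T := by ring
        omega
      have hk : ∑ k ∈ Finset.range T, x ((n + 1) * T - 1 + k) ≤
          T * (x ((n + 1) * T - 1) + T * L) := by
        calc _ ≤ ∑ _k ∈ Finset.range T, (x ((n + 1) * T - 1) + T * L) := by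
              refine Finset.sum_le_sum fun k hk => (hadd _ k).trans ?_
              have : (k : ℝ) ≤ T := by exact_mod_cast (Finset.mem_range.mp hk).le
              gcongr
          _ = _ := by rw [Finset.sum_const, Finset.card_range, nsmul_eq_mul]
      rw [hsplit, Finset.sum_range_add, Finset.sum_range_succ]
      push_cast
      nlinarith
  set D : ℝ := ∑ τ ∈ Finset.range (T - 1), x τ with hD
  have hD0 : 0 ≤ D := Finset.sum_nonneg fun τ _ => hx τ
  have hφ0 := hφ 0
  refine ⟨D + T * (φ 0 / c) + T * (B / c) + T * (T * L), by positivity, fun t => ?_⟩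
  -- `t` periods suffice to cover `t` slots; only the linear growth in `t` matters.
  have ht : t ≤ (t + 1) * T - 1 := by
    have : t + 1 ≤ (t + 1) * T := Nat.le_mul_of_pos_right _ hT
    omega
  have h1 : ∑ τ ∈ Finset.range t, x τ ≤ ∑ τ ∈ Finset.range ((t + 1) * T - 1), x τ :=
    Finset.sum_le_sum_of_subset_of_nonneg (Finset.range_subset_range.mpr ht) fun τ _ _ => hx τ
  have h2 : ∑ m ∈ Finset.range t, x ((m + 1) * T - 1) ≤ φ 0 / c + t * (B / c) := by
    have := htel t
    have h3 : c * ∑ m ∈ Finset.range t, x ((m + 1) * T - 1) ≤ c * (φ 0 / c + t * (B / c)) := by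
      have h4 : c * (φ 0 / c + t * (B / c)) = φ 0 + t * B := by field_simp
      linarith [hφ t]
    exact le_of_mul_le_mul_left h3 hc
  have h5 : (T : ℝ) * ∑ m ∈ Finset.range t, x ((m + 1) * T - 1) ≤
      T * (φ 0 / c + t * (B / c)) := by gcongr
  have h6 := h1.trans (hblock t)
  have e1 : 0 ≤ T * (φ 0 / c) * t := by positivity
  have e2 : 0 ≤ T * (B / c) := by positivity
  have e3 : 0 ≤ T * (T * L) := by positivity
  have e4 : 0 ≤ D * t := by positivity
  linarith

namespace Switch

variable {K : ℕ} {Ω : Type*} [mΩ : MeasurableSpace Ω] {S : Switch K Ω} {μ : Measure Ω}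
  [IsProbabilityMeasure μ] {p : Fin K → ℝ} {q : ℝ} {lam : Pair K → ℝ}

/-- Markov's inequality. -/
lemma IsModel.measureReal_pending_gt_le (hM : S.IsModel μ p q lam) (hP : S.IsProtocol) (t : ℕ)
    (e : Pair K) {V : ℝ} (hV : 0 < V) :
    μ.real {ω | V < (S.pending t ω e : ℝ)} ≤ S.meanPending μ t e / V := by
  rw [le_div_iff₀ hV, mul_comm]
  have h := mul_meas_ge_le_lintegral (μ := μ)
    ((measurable_of_countable fun n : ℕ => (n : ℝ≥0∞)).comp (hM.measurable_pending hP t e))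
    (ENNReal.ofReal V)
  have h2 : ENNReal.ofReal V * μ {ω | V < (S.pending t ω e : ℝ)} ≤
      ∫⁻ ω, (S.pending t ω e : ℝ≥0∞) ∂μ := by
    refine le_trans ?_ h
    gcongr with ω
    intro hω
    simpa using ENNReal.ofReal_le_ofReal hω.le
  have h3 := ENNReal.toReal_mono (hM.lintegral_pending_ne_top t e) h2
  rwa [ENNReal.toReal_mul, ENNReal.toReal_ofReal hV.le] at h3

lemma isStable_of_sum_meanPending_le (hM : S.IsModel μ p q lam) (hP : S.IsProtocol)
    (h : ∀ e, ∃ C : ℝ, 0 ≤ C ∧ ∀ t : ℕ,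
      ∑ τ ∈ Finset.range t, S.meanPending μ τ e ≤ C * (t + 1)) : S.IsStable μ := by
  intro e
  obtain ⟨C, hC, hsum⟩ := h e
  have havg : ∀ V : ℝ, 0 < V → ∀ t : ℕ, (1 / (t : ℝ)) *
      ∑ τ ∈ Finset.range t, μ.real {ω | V < (S.pending τ ω e : ℝ)} ≤ 2 * C / V := by
    intro V hV t
    rcases Nat.eq_zero_or_pos t with rfl | ht
    · simp only [Finset.range_zero, Finset.sum_empty, mul_zero]
      positivity
    · have ht1 : (1 : ℝ) ≤ t := by exact_mod_cast ht
      rw [one_div, inv_mul_le_iff₀ (by linarith)]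
      calc _ ≤ ∑ τ ∈ Finset.range t, S.meanPending μ τ e / V :=
            Finset.sum_le_sum fun τ _ => hM.measureReal_pending_gt_le hP τ e hV
        _ = (∑ τ ∈ Finset.range t, S.meanPending μ τ e) / V := by rw [Finset.sum_div]
        _ ≤ (t * (2 * C)) / V := by
            gcongr
            refine (hsum t).trans ?_
            nlinarith
        _ = t * (2 * C / V) := by ring
  have hnn : ∀ (V : ℝ) (t : ℕ), 0 ≤ (1 / (t : ℝ)) *
      ∑ τ ∈ Finset.range t, μ.real {ω | V < (S.pending τ ω e : ℝ)} := fun V t => by positivity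
  refine tendsto_of_tendsto_of_tendsto_of_le_of_le' tendsto_const_nhds
    (tendsto_const_nhds.div_atTop tendsto_id : Tendsto (fun V : ℝ => 2 * C / V) atTop (𝓝 0)) ?_ ?_
  · filter_upwards [eventually_gt_atTop 0] with V hV
    exact le_limsup_of_frequently_le (Frequently.of_forall (hnn V))
      (isBoundedUnder_of ⟨_, havg V hV⟩)
  · filter_upwards [eventually_gt_atTop 0] with V hV
    exact limsup_le_of_le (isCoboundedUnder_le_of_le _ (hnn V))
      (Eventually.of_forall (havg V hV))

lemma isStable_of_isMaxWeight (hp : ∀ k, 0 ≤ p k ∧ p k ≤ 1) (hq : 0 ≤ q ∧ q ≤ 1)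
    (hlam : ∀ e, 0 ≤ lam e) {ε : ℝ} (hε : 0 < ε) {f : Pair K → ℝ} {δ : ℝ} {T : ℕ}
    (hper : IsPeriod p q lam ε f δ T) (hM : S.IsModel μ p q lam)
    (hR : S.MeanRequestsNear μ lam δ T) (hP : S.IsProtocol) (hW : S.IsMaxWeight T) :
    S.IsStable μ := by
  obtain ⟨B, hB, hdrift⟩ := meanLyapunov_add_le hp hq hlam hε hper hM hR hP hW
  have hT := hper.T₀_pos
  have hT' : (0 : ℝ) < T := by exact_mod_cast hT
  obtain ⟨C, hC, hsum⟩ := exists_sum_range_le_of_drift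
    (x := fun t => ∑ i, ∑ j, S.meanPending μ t s(i, j))
    (φ := fun m => S.meanLyapunov μ T ((m + 1) * T - 1)) (c := T * ε / 2) (B := B)
    (L := ∑ i : Fin K, ∑ j : Fin K, lam s(i, j)) hT
    (fun t => Finset.sum_nonneg fun i _ => Finset.sum_nonneg fun j _ => meanPending_nonneg _ _)
    (fun m => ENNReal.toReal_nonneg) (by positivity) hB
    (Finset.sum_nonneg fun i _ => Finset.sum_nonneg fun j _ => hlam _)
    (fun t => by
      simp only [← Finset.sum_add_distrib]
      refine Finset.sum_le_sum fun i _ => Finset.sum_le_sum fun j _ => ?_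
      simpa using meanPending_add_le hlam hM t 1 s(i, j))
    (fun m => by
      have hpos : T ≤ (m + 1) * T := Nat.le_mul_of_pos_left _ (Nat.succ_pos m)
      have h := hdrift ((m + 1) * T - 1) ⟨m + 1, by
        rw [Nat.sub_add_cancel (by omega), mul_comm]⟩
      have hnext : (m + 1) * T - 1 + T = (m + 1 + 1) * T - 1 := by
        have h2 : (m + 1 + 1) * T = (m + 1) * T + T := by ring
        omega
      rwa [hnext] at h)
  refine isStable_of_sum_meanPending_le hM hP fun e => ⟨C, hC, fun t => ?_⟩
  refine le_trans (Finset.sum_le_sum fun τ _ => ?_) (hsum t)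
  induction e using Sym2.ind with
  | _ i j =>
    refine (Finset.single_le_sum (f := fun j => S.meanPending μ τ s(i, j))
      (fun _ _ => meanPending_nonneg _ _) (Finset.mem_univ j)).trans ?_
    exact Finset.single_le_sum (f := fun i => ∑ j, S.meanPending μ τ s(i, j))
      (fun _ _ => Finset.sum_nonneg fun _ _ => meanPending_nonneg _ _) (Finset.mem_univ i)

end Switch

end QuantumSwitch

theorem mainTheorem3 {K : ℕ} (p : Fin K → ℝ) (q : ℝ)
    (hp : ∀ k, 0 ≤ p k ∧ p k ≤ 1) (hq : 0 ≤ q ∧ q ≤ 1)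
    (lam : QuantumSwitch.Pair K → ℝ) (hlam : ∀ e, 0 ≤ lam e)
    (ε : ℝ) (hε : 0 < ε)
    (hΛ : (fun e => lam e + ε) ∈ QuantumSwitch.capacityRegion p q) :
    (∃ (f : QuantumSwitch.Pair K → ℝ) (δ : ℝ) (N : ℕ),
      ∀ T₀, N ≤ T₀ → QuantumSwitch.IsPeriod p q lam ε f δ T₀) ∧
    ∀ (f : QuantumSwitch.Pair K → ℝ) (δ : ℝ) (T₀ : ℕ),
      QuantumSwitch.IsPeriod p q lam ε f δ T₀ →
      ∀ {Ω : Type*} [MeasurableSpace Ω] (μ : MeasureTheory.Measure Ω)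
        [MeasureTheory.IsProbabilityMeasure μ] (S : QuantumSwitch.Switch K Ω),
        S.IsModel μ p q lam → S.MeanRequestsNear μ lam δ T₀ →
        S.IsProtocol → S.IsMaxWeight T₀ → S.IsStable μ :=
  ⟨QuantumSwitch.exists_isPeriod hp hq hε hΛ, fun _ _ _ hper _ _ _ _ _ hM hR hP hW =>
    QuantumSwitch.Switch.isStable_of_isMaxWeight hp hq hlam hε hper hM hR hP hW⟩
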